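/- Let $X$ be a compact complex manifold and $E\to X$ a holomorphic vector bundle of (constant) finite rank. Let $\overline X$ denote $X$ with the opposite complex structure, $\overline E\to\overline X$ the conjugate bundle (same real bundle, with multiplication by $\lambda\in\mathbb C$ on the fibres $\overline E_y$ given by multiplication by $\bar\lambda$ in $E_y$), and $E\boxtimes\overline E\to X\times\overline X$ the holomorphic vector bundle with fibres $E_x\otimes\overline E_y$. Let $\mathcal O(E)$ be the space of holomorphic sections of $E$, and $\mathcal I_E$ the finite dimensional real vector space of inner products on $\mathcal O(E)^*$, i.e. of hermitian symmetric sesquilinear maps $\mathcal O(E)^*\times\mathcal O(E)^*\to\mathbb C$ (linear in the first variable; not necessarily definite or nondegenerate). Let $\mathcal O(E\boxtimes\overline E)^{\rm herm}$ be the real vector space of holomorphic sections $L$ of $E\boxtimes\overline E$ with $\iota L(x,y)=L(y,x)$ for all $x,y$, where $\iota(e\otimes f)=f\otimes e$, with the topology of uniform convergence on compact sets in local trivializations; and let $C^\infty(E\otimes\overline E)^{\rm herm}$ be the Fréchet space of smooth sections $k$ of $E\otimes\overline E\to X$ with $\iota k(x)=k(x)$ for all $x$. For $x\in X$ let $\mathrm{ev}_x:\mathcal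 O(E)\to E_x$ be evaluation; for $\eta\in E_y^*$ let $\overline\eta\in\overline E_y^*$ be the conjugate linear form. For every $\langle\langle\,,\rangle\rangle\in\mathcal I_E$ there is exactly one section $K$ of $E\boxtimes\overline E$ (its Bergman kernel) such that $$\langle\langle\xi\,\mathrm{ev}_x,\eta\,\mathrm{ev}_y\rangle\rangle=(\xi\otimes\overline\eta)K(x,y)\qquad\text{for all }x,y\in X,\ \xi\in E_x^*,\ \eta\in E_y^*.$$ It belongs to $\mathcal O(E\boxtimes\overline E)^{\rm herm}$, and its restriction to the diagonal, $k(x)=K(x,x)$ (the Bergman section), belongs to $C^\infty(E\otimes\overline E)^{\rm herm}$. Put $B(\langle\langle\,,\rangle\rangle)=K$ and $\beta(\langle\langle\,,\rangle\rangle)=k$. (a) $B:\mathcal I_E\to\mathcal O(E\boxtimes\overline E)^{\rm herm}$ is an isomorphism of topological real vector spaces. The map $\beta:\mathcal I_E\to C^\infty(E\otimes\overline E)^{\rm herm}$ is linear and continuous, and, if $X$ is connected, it is an isomorphism of topological real vector spaces between $\mathcal I_E$ and its image $\beta(\mathcal I_E)\subset C^\infty(E\otimes\overline E)^{\rm herm}$.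 (b) An inner product $\langle\langle\,,\rangle\rangle\in\mathcal I_E$ is positive semidefinite if and only if, with $K=B(\langle\langle\,,\rangle\rangle)$, for arbitrary choice of finitely many $x_j\in X$ and $\xi_j\in E_{x_j}^*$ the matrix $\big((\xi_i\otimes\overline{\xi_j})K(x_i,x_j)\big)_{i,j}$ is hermitian and positive semidefinite. -/

import Mathlib

open Bundle
open scoped Manifold ContDiff TensorProduct ComplexConjugate ComplexOrder Topology UniformConvergence

noncomputable section

/-! ### Conjugate vector spaces -/

/-- The conjugate `V̄` of a complex vector space `V`: the same additive group, in which `c : ℂ` acts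
as its complex conjugate acts on `V`. -/
def ConjSpace (V : Type*) : Type _ := V

namespace ConjSpace

instance instAddCommGroup (V : Type*) [AddCommGroup V] : AddCommGroup (ConjSpace V) :=
  inferInstanceAs (AddCommGroup V)

instance instNormedAddCommGroup (V : Type*) [NormedAddCommGroup V] :
    NormedAddCommGroup (ConjSpace V) :=
  inferInstanceAs (NormedAddCommGroup V)

/-- The identity map from `V` to its conjugate. -/
def toConjAdd (V : Type*) [AddCommGroup V] : V ≃+ ConjSpace V := AddEquiv.refl V

instance instModule (V : Type*) [AddCommGroup V] [Module ℂ V] : Module ℂ (ConjSpace V) where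
  smul c v := toConjAdd V (conj c • (toConjAdd V).symm v)
  one_smul v := by
    change conj (1 : ℂ) • (toConjAdd V).symm v = (toConjAdd V).symm v
    rw [map_one, one_smul]
  mul_smul a b v := by
    change conj (a * b) • (toConjAdd V).symm v = conj a • conj b • (toConjAdd V).symm v
    rw [map_mul, mul_smul]
  smul_zero a := smul_zero (A := V) (conj a)
  smul_add a v w := smul_add (A := V) (conj a) v w
  add_smul a b v := by
    change conj (a + b) • (toConjAdd V).symm v =
      conj a • (toConjAdd V).symm v + conj b • (toConjAdd V).symm v
    rw [map_add, add_smul]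
  zero_smul v := by
    change conj (0 : ℂ) • (toConjAdd V).symm v = 0
    rw [map_zero, zero_smul]

instance instNormedSpace (V : Type*) [NormedAddCommGroup V] [NormedSpace ℂ V] :
    NormedSpace ℂ (ConjSpace V) where
  norm_smul_le c v := by
    change ‖conj c • (toConjAdd V).symm v‖ ≤ ‖c‖ * ‖(toConjAdd V).symm v‖
    rw [norm_smul, RCLike.norm_conj]

variable (V : Type*) [AddCommGroup V] [Module ℂ V] {W : Type*} [AddCommGroup W] [Module ℂ W]

/-- The identity map `V → V̄`, which is conjugate linear. -/
def toConj : V →ₛₗ[starRingEnd ℂ] ConjSpace V where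
  toFun := toConjAdd V
  map_add' := map_add _
  map_smul' c v := by
    change c • v = conj (conj c) • v
    rw [Complex.conj_conj]

/-- The identity map `V̄ → V`, which is conjugate linear. -/
def ofConj : ConjSpace V →ₛₗ[starRingEnd ℂ] V where
  toFun := (toConjAdd V).symm
  map_add' := map_add _
  map_smul' _ _ := rfl

variable {V}

/-- A linear map `V → W`, viewed as a linear map `V̄ → W̄`. -/
def map (f : V →ₗ[ℂ] W) : ConjSpace V →ₗ[ℂ] ConjSpace W :=
  ((toConj W).comp f).comp (ofConj V)

/-- The conjugate `ξ̄` of a linear form `ξ` on `V`: a linear form on `V̄`. -/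
def conjForm (ξ : Module.Dual ℂ V) : Module.Dual ℂ (ConjSpace V) where
  toFun v := conj (ξ (ofConj V v))
  map_add' v w := by simp
  map_smul' c v := by simp

end ConjSpace

/-- The model with corners of conjugate complex manifolds. A complex manifold `X` modelled on `EB`
is a charted space `X` over `EB` with the model `𝓘(ℂ, EB)`; the conjugate manifold `X̄` is the same
charted space with the model `conjModel EB`, i.e. the same charts, read as maps to the conjugate
of `EB`. -/
def conjModel (EB : Type*) [NormedAddCommGroup EB] [NormedSpace ℂ EB] :
    ModelWithCorners ℂ (ConjSpace EB) EB :=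
  ModelWithCorners.ofTargetUniv ℂ (ConjSpace.toConjAdd EB).toEquiv.toPartialEquiv rfl rfl
    continuous_id continuous_id

/-! ### Tensors -/

/-- The flip `A ⊗ B̄ → B ⊗ Ā`, `e ⊗ f ↦ f ⊗ e`. It is conjugate linear, hence real linear. -/
def tensorFlip (A B : Type*) [AddCommGroup A] [Module ℂ A] [AddCommGroup B] [Module ℂ B] :
    A ⊗[ℂ] ConjSpace B →ₛₗ[starRingEnd ℂ] B ⊗[ℂ] ConjSpace A :=
  (TensorProduct.comm ℂ (ConjSpace A) B).toLinearMap.comp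
    (TensorProduct.map (ConjSpace.toConj A) (ConjSpace.ofConj B))

/-- The linear form `ξ ⊗ η̄` on `A ⊗ B̄`. -/
def formTensorConj {A B : Type*} [AddCommGroup A] [Module ℂ A] [AddCommGroup B] [Module ℂ B]
    (ξ : Module.Dual ℂ A) (η : Module.Dual ℂ B) : Module.Dual ℂ (A ⊗[ℂ] ConjSpace B) :=
  TensorProduct.dualDistrib ℂ A (ConjSpace B) (ξ ⊗ₜ[ℂ] ConjSpace.conjForm η)

/-! ### Inner products -/

/-- The real vector space of inner products on a complex vector space `W`: hermitian symmetric
sesquilinear maps `W × W → ℂ`, linear in the first variable. No definiteness or nondegeneracy is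
required. -/
def InnerProducts (W : Type*) [AddCommGroup W] [Module ℂ W] :
    Submodule ℝ (W →ₗ[ℂ] W →ₛₗ[starRingEnd ℂ] ℂ) where
  carrier := {h | ∀ σ τ, h τ σ = conj (h σ τ)}
  zero_mem' σ τ := by simp
  add_mem' {g h} hg hh σ τ := by simp [hg σ τ, hh σ τ]
  smul_mem' r h hh σ τ := by simp [hh σ τ]

/-- The topology of pointwise convergence. When `W` is finite dimensional, so is `InnerProducts W`,
and this is its only Hausdorff vector space topology. -/
instance InnerProducts.instTopologicalSpace (W : Type*) [AddCommGroup W] [Module ℂ W] :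
    TopologicalSpace (InnerProducts W) :=
  TopologicalSpace.induced (fun h (p : W × W) => h.1 p.1 p.2) inferInstance

/-- Positive semidefinite inner products (`h σ σ` is real for every inner product `h`). -/
def InnerProducts.IsPosSemidef {W : Type*} [AddCommGroup W] [Module ℂ W]
    (h : InnerProducts W) : Prop :=
  ∀ σ, 0 ≤ (h.1 σ σ).re

/-! ### Sections of `E` -/

section Bundles

variable (EB : Type*) [NormedAddCommGroup EB] [NormedSpace ℂ EB]
  (F : Type*) [NormedAddCommGroup F] [NormedSpace ℂ F]
  {X : Type*} [TopologicalSpace X] [ChartedSpace EB X]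
  (E : X → Type*) [TopologicalSpace (TotalSpace F E)] [∀ x, TopologicalSpace (E x)]
  [∀ x, AddCommGroup (E x)] [∀ x, Module ℂ (E x)] [FiberBundle F E] [VectorBundle ℂ F E]

/-- The space `𝒪(E)` of holomorphic sections of `E → X`. -/
abbrev HolSections := Cₛ^ω⟮𝓘(ℂ, EB); F, E⟯

/-- The evaluation map `ev_x : 𝒪(E) → E_x`. -/
def evalAt (x : X) : HolSections EB F E →ₗ[ℂ] E x where
  toFun s := s x
  map_add' _ _ := rfl
  map_smul' _ _ := rfl

/-- The map `E_x ⊗ Ē_y → F ⊗ F̄` induced by the local trivializations of `E` around `x₀` and `y₀`.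
It is an isomorphism when `x` and `y` are in the respective base sets. -/
def tensorTriv (x₀ y₀ x y : X) : E x ⊗[ℂ] ConjSpace (E y) →ₗ[ℂ] F ⊗[ℂ] ConjSpace F :=
  TensorProduct.map ((trivializationAt F E x₀).linearMapAt ℂ x)
    (ConjSpace.map ((trivializationAt F E y₀).linearMapAt ℂ y))

/-! ### Holomorphic sections of `E ⊠ Ē → X × X̄` -/

/-- A section `L` of `E ⊠ Ē → X × X̄` is holomorphic if it is so in the local trivializations
induced by those of `E` and `Ē`: all components of the resulting maps to the finite dimensional
space `F ⊗ F̄` are holomorphic functions on open subsets of `X × X̄`. -/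
def IsHolKernel (L : ∀ x y : X, E x ⊗[ℂ] ConjSpace (E y)) : Prop :=
  ∀ (x₀ y₀ : X) (l : Module.Dual ℂ (F ⊗[ℂ] ConjSpace F)),
    ContMDiffOn (𝓘(ℂ, EB).prod (conjModel EB)) 𝓘(ℂ, ℂ) ω
      (fun p : X × X => l (tensorTriv F E x₀ y₀ p.1 p.2 (L p.1 p.2)))
      ((trivializationAt F E x₀).baseSet ×ˢ (trivializationAt F E y₀).baseSet)

/-- The real vector space `𝒪(E ⊠ Ē)^herm` of the holomorphic sections `L` of `E ⊠ Ē` such that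
the flip of `L x y` is `L y x`. -/
def HolHermKernels : Submodule ℝ (∀ x y : X, E x ⊗[ℂ] ConjSpace (E y)) where
  carrier := {L | IsHolKernel EB F E L ∧ ∀ x y, tensorFlip (E x) (E y) (L x y) = L y x}
  zero_mem' := by
    refine ⟨fun x₀ y₀ l => ?_, fun x y => by simp⟩
    simpa using contMDiffOn_const
  add_mem' {L M} hL hM := by
    refine ⟨fun x₀ y₀ l => ?_, fun x y => by simp [hL.2 x y, hM.2 x y]⟩
    exact ((hL.1 x₀ y₀ l).add (hM.1 x₀ y₀ l)).congr fun p _ => by simp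
  smul_mem' r L hL := by
    refine ⟨fun x₀ y₀ l => ?_, fun x y => ?_⟩
    · have h := (contMDiffOn_const (c := (r : ℂ))).mul (hL.1 x₀ y₀ l)
      refine h.congr fun p _ => ?_
      simp only [Pi.smul_apply, LinearMap.map_smul_of_tower, Complex.real_smul, Pi.mul_apply]
    · rw [Pi.smul_apply, Pi.smul_apply, Pi.smul_apply, Pi.smul_apply, ← hL.2 x y,
        ← algebraMap_smul ℂ r (L x y), LinearMap.map_smulₛₗ, ← algebraMap_smul ℂ r (tensorFlip (E x) (E y) (L x y))]
      simp

/-- The topology of `𝒪(E ⊠ Ē)^herm`: in the local trivializations, uniform convergence on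
compact sets. -/
instance HolHermKernels.instTopologicalSpace : TopologicalSpace (HolHermKernels EB F E) :=
  ⨅ (x₀ : X) (y₀ : X) (l : Module.Dual ℂ (F ⊗[ℂ] ConjSpace F)),
    TopologicalSpace.induced
      (fun L => UniformOnFun.ofFun
        {C : Set (X × X) | IsCompact C ∧
          C ⊆ (trivializationAt F E x₀).baseSet ×ˢ (trivializationAt F E y₀).baseSet}
        (fun p : X × X => l (tensorTriv F E x₀ y₀ p.1 p.2 (L.1 p.1 p.2))))
      inferInstance

/-! ### Smooth sections of `E ⊗ Ē → X` -/

/-- A section `k` of `E ⊗ Ē → X` is smooth if it is so in the local trivializations induced by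
those of `E`. Here `X` is viewed as a real manifold. -/
def IsSmoothSection (k : ∀ x : X, E x ⊗[ℂ] ConjSpace (E x)) : Prop :=
  ∀ (x₀ : X) (l : Module.Dual ℂ (F ⊗[ℂ] ConjSpace F)),
    ContMDiffOn 𝓘(ℝ, EB) 𝓘(ℝ, ℂ) ∞ (fun x : X => l (tensorTriv F E x₀ x₀ x x (k x)))
      (trivializationAt F E x₀).baseSet

/-- The real vector space `C^∞(E ⊗ Ē)^herm` of smooth sections of the bundle of the elements of
`E ⊗ Ē → X` that are fixed by the flip. -/
def SmoothHermSections : Submodule ℝ (∀ x : X, E x ⊗[ℂ] ConjSpace (E x)) where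
  carrier := {k | IsSmoothSection EB F E k ∧ ∀ x, tensorFlip (E x) (E x) (k x) = k x}
  zero_mem' := by
    refine ⟨fun x₀ l => ?_, fun x => by simp⟩
    simpa using contMDiffOn_const
  add_mem' {L M} hL hM := by
    refine ⟨fun x₀ l => ?_, fun x => by simp [hL.2 x, hM.2 x]⟩
    exact ((hL.1 x₀ l).add (hM.1 x₀ l)).congr fun p _ => by simp
  smul_mem' r L hL := by
    refine ⟨fun x₀ l => ?_, fun x => ?_⟩
    · refine ((contMDiffOn_const (I' := 𝓘(ℝ, ℝ)) (c := r)).smul (hL.1 x₀ l)).congr fun p _ => ?_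
      simp only [Pi.smul_apply, Pi.smul_apply', LinearMap.map_smul_of_tower]
    · rw [Pi.smul_apply, ← algebraMap_smul ℂ r (L x), LinearMap.map_smulₛₗ, hL.2 x]
      simp

/-- The Fréchet topology of `C^∞(E ⊗ Ē)^herm`: in local charts and trivializations, uniform
convergence of all derivatives on compact sets. -/
instance SmoothHermSections.instTopologicalSpace : TopologicalSpace (SmoothHermSections EB F E) :=
  ⨅ (x₀ : X) (l : Module.Dual ℂ (F ⊗[ℂ] ConjSpace F)) (m : ℕ),
    TopologicalSpace.induced
      (fun k => UniformOnFun.ofFun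
        {C : Set EB | IsCompact C ∧ C ⊆ (chartAt EB x₀).target ∩
          (chartAt EB x₀).symm ⁻¹' (trivializationAt F E x₀).baseSet}
        (iteratedFDeriv ℝ m fun z : EB =>
          l (tensorTriv F E x₀ x₀ ((chartAt EB x₀).symm z) ((chartAt EB x₀).symm z)
            (k.1 ((chartAt EB x₀).symm z)))))
      inferInstance

/-! ### Bergman kernels -/

/-- `K` is the Bergman kernel of the inner product `h` on `𝒪(E)*`:
`h (ξ ev_x) (η ev_y) = (ξ ⊗ η̄) K(x, y)` for all `x, y ∈ X`, `ξ ∈ E_x*`, `η ∈ E_y*`. -/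
def IsBergmanKernel (h : InnerProducts (Module.Dual ℂ (HolSections EB F E)))
    (K : ∀ x y : X, E x ⊗[ℂ] ConjSpace (E y)) : Prop :=
  ∀ (x y : X) (ξ : Module.Dual ℂ (E x)) (η : Module.Dual ℂ (E y)),
    h.1 (ξ ∘ₗ evalAt EB F E x) (η ∘ₗ evalAt EB F E y) = formTensorConj ξ η (K x y)

end Bundles

end

/-! Everything reduces to finitely many evaluations. On compact `X` a section that vanishes on a
suitable finite set of points is zero (`exists_finite_points`): if the points are dense enough, the
Schwarz lemma bounds the supremum `M` of the section by `M / 2`. Hence `𝒪(E)` is finite dimensional.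
The forms `ξ ev_x` span its dual, because a section annihilated by all of them is zero. So `𝒪(E)*`
has a basis of forms `ζ_a ev_{p_a}`, with a dual basis of sections `s_a`; this is an `EvalFrame`.

An inner product is then the same as its Gram matrix `h_{ab}` on the frame, and its Bergman kernel
is `∑ h_{ab} s_a(x) ⊗ s̄_b(y)`. This shows holomorphy, linearity and continuity at once. Conversely,
contracting a holomorphic hermitian `L` with `η̄` at `y` gives a holomorphic section in `x`, which
its values on the frame determine; hermitian symmetry gives the same in `y`. Therefore `L` is
recovered from the numbers `(ζ_a ⊗ ζ̄_b) L(p_a, p_b)`, which define the inverse of `B`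
(`isBergmanKernel_innerOf`).

Injectivity of `β` is polarization: a kernel holomorphic in `x` and antiholomorphic in `y` that
vanishes on the diagonal vanishes near it (`sum_mul_conj_eq_zero_of_diag`), and for connected `X`
the identity theorem in `x` extends this to all of `X × X`. An injective continuous linear map from
a finite dimensional space is an embedding once continuous linear functions separate the points of
its target. Part (b) compares Gram matrices. -/

noncomputable section

/-! ### Holomorphic sections: identity theorem, finite dimensionality, evaluation frames -/

namespace HolSections

open Set Metric

variable {EB : Type*} [NormedAddCommGroup EB] [NormedSpace ℂ EB]
  {F : Type*} [NormedAddCommGroup F] [NormedSpace ℂ F]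
  {X : Type*} [TopologicalSpace X] [ChartedSpace EB X]
  {E : X → Type*} [TopologicalSpace (TotalSpace F E)] [∀ x, TopologicalSpace (E x)]
  [∀ x, AddCommGroup (E x)] [∀ x, Module ℂ (E x)] [FiberBundle F E] [VectorBundle ℂ F E]

/-- The local trivialization of `E` around `x₀`, as a linear map from the fibre over `x`. -/
abbrev trivAt (F : Type*) [NormedAddCommGroup F] [NormedSpace ℂ F]
    {X : Type*} [TopologicalSpace X] (E : X → Type*) [TopologicalSpace (TotalSpace F E)]
    [∀ x, TopologicalSpace (E x)] [∀ x, AddCommGroup (E x)] [∀ x, Module ℂ (E x)]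
    [FiberBundle F E] [VectorBundle ℂ F E] (x₀ x : X) : E x →ₗ[ℂ] F :=
  (trivializationAt F E x₀).linearMapAt ℂ x

theorem trivAt_injective {x₀ x : X} (hx : x ∈ (trivializationAt F E x₀).baseSet) :
    Function.Injective (trivAt F E x₀ x) := by
  have h : ⇑(trivAt F E x₀ x) =
      (trivializationAt F E x₀).linearEquivAt ℂ x hx := by
    rw [trivAt, Trivialization.coe_linearMapAt_of_mem _ hx]
    rfl
  rw [h]
  exact LinearEquiv.injective _

theorem finiteDimensional_fiber [FiniteDimensional ℂ F] (x : X) : FiniteDimensional ℂ (E x) :=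
  FiniteDimensional.of_injective (trivAt F E x x)
    (trivAt_injective (mem_baseSet_trivializationAt F E x))

theorem contMDiffOn_trivAt_iff [ContMDiffVectorBundle ω F E 𝓘(ℂ, EB)] (s : ∀ x, E x) (x₀ : X) :
    ContMDiffOn 𝓘(ℂ, EB) (𝓘(ℂ, EB).prod 𝓘(ℂ, F)) ω (fun x => TotalSpace.mk' F x (s x))
      (trivializationAt F E x₀).baseSet ↔
    ContMDiffOn 𝓘(ℂ, EB) 𝓘(ℂ, F) ω (fun x => trivAt F E x₀ x (s x))
      (trivializationAt F E x₀).baseSet := by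
  refine (Trivialization.contMDiffOn_section_baseSet_iff (IB := 𝓘(ℂ, EB)) (n := ω) (s := s)
    (trivializationAt F E x₀)).trans (contMDiffOn_congr fun x hx => ?_)
  rw [trivAt, Trivialization.coe_linearMapAt_of_mem _ hx]

theorem contMDiffOn_trivAt [ContMDiffVectorBundle ω F E 𝓘(ℂ, EB)] (s : HolSections EB F E)
    (x₀ : X) :
    ContMDiffOn 𝓘(ℂ, EB) 𝓘(ℂ, F) ω (fun x => trivAt F E x₀ x (s x))
      (trivializationAt F E x₀).baseSet :=
  (contMDiffOn_trivAt_iff (fun x => s x) x₀).1 s.contMDiff.contMDiffOn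

/-- The open subset of the model space over which both the chart and the local trivialization at
`x₀` are defined. -/
def chartDomain (EB : Type*) [NormedAddCommGroup EB] [NormedSpace ℂ EB] (F : Type*)
    [NormedAddCommGroup F] [NormedSpace ℂ F] {X : Type*} [TopologicalSpace X] [ChartedSpace EB X]
    (E : X → Type*) [TopologicalSpace (TotalSpace F E)] [∀ x, TopologicalSpace (E x)]
    [∀ x, AddCommGroup (E x)] [∀ x, Module ℂ (E x)] [FiberBundle F E] [VectorBundle ℂ F E]
    (x₀ : X) : Set EB :=
  (chartAt EB x₀).target ∩ (chartAt EB x₀).symm ⁻¹' (trivializationAt F E x₀).baseSet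

theorem isOpen_chartDomain (x₀ : X) : IsOpen (chartDomain EB F E x₀) :=
  (chartAt EB x₀).isOpen_inter_preimage_symm (trivializationAt F E x₀).open_baseSet

theorem mem_chartDomain_self (x₀ : X) : chartAt EB x₀ x₀ ∈ chartDomain EB F E x₀ :=
  ⟨mem_chart_target EB x₀, by simp [mem_baseSet_trivializationAt]⟩

/-- A section read in the chart and the local trivialization at `x₀`. -/
def localRep (EB : Type*) [NormedAddCommGroup EB] [NormedSpace ℂ EB] (F : Type*)
    [NormedAddCommGroup F] [NormedSpace ℂ F] {X : Type*} [TopologicalSpace X] [ChartedSpace EB X]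
    {E : X → Type*} [TopologicalSpace (TotalSpace F E)] [∀ x, TopologicalSpace (E x)]
    [∀ x, AddCommGroup (E x)] [∀ x, Module ℂ (E x)] [FiberBundle F E] [VectorBundle ℂ F E]
    (x₀ : X) (s : ∀ x, E x) (z : EB) : F :=
  trivAt F E x₀ ((chartAt EB x₀).symm z) (s ((chartAt EB x₀).symm z))

theorem contDiffOn_localRep [IsManifold 𝓘(ℂ, EB) ω X] [ContMDiffVectorBundle ω F E 𝓘(ℂ, EB)]
    (s : HolSections EB F E) (x₀ : X) :
    ContDiffOn ℂ ω (localRep EB F x₀ s) (chartDomain EB F E x₀) := by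
  refine ContMDiffOn.contDiffOn ?_
  exact (contMDiffOn_trivAt s x₀).comp
    ((contMDiffOn_chart_symm (I := 𝓘(ℂ, EB)) (n := ω) (x := x₀)).mono inter_subset_left)
    (fun z hz => hz.2)

theorem analyticOnNhd_localRep [IsManifold 𝓘(ℂ, EB) ω X]
    [ContMDiffVectorBundle ω F E 𝓘(ℂ, EB)] (s : HolSections EB F E) (x₀ : X) :
    AnalyticOnNhd ℂ (localRep EB F x₀ s) (chartDomain EB F E x₀) :=
  (isOpen_chartDomain x₀).analyticOn_iff_analyticOnNhd.1 (contDiffOn_localRep s x₀).analyticOn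

/-- The identity theorem for holomorphic sections. -/
theorem eq_zero_of_eventually_eq_zero [PreconnectedSpace X] [IsManifold 𝓘(ℂ, EB) ω X]
    [ContMDiffVectorBundle ω F E 𝓘(ℂ, EB)] (s : HolSections EB F E) {x : X}
    (h : ∀ᶠ y in 𝓝 x, s y = 0) (y : X) : s y = 0 := by
  let U : Set X := {x | ∀ᶠ y in 𝓝 x, s y = 0}
  have hUo : IsOpen U := isOpen_setOfPred_eventually_nhds
  -- A chart ball around a limit point meets the open set `U`, and the identity theorem on the ball
  -- spreads the vanishing to all of it.
  have hUc : IsClosed U := by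
    refine isClosed_of_closure_subset fun x₀ hx₀ => ?_
    obtain ⟨r, hr, hball⟩ := Metric.isOpen_iff.1 (isOpen_chartDomain (EB := EB) (F := F) (E := E) x₀)
      _ (mem_chartDomain_self x₀)
    let φ := chartAt EB x₀
    have hV : φ.source ∩ φ ⁻¹' ball (φ x₀) r ∈ 𝓝 x₀ :=
      (φ.isOpen_inter_preimage isOpen_ball).mem_nhds ⟨mem_chart_source EB x₀, mem_ball_self hr⟩
    obtain ⟨p, ⟨hp1, hp2⟩, hpU⟩ := mem_closure_iff_nhds.1 hx₀ _ hV
    have hz : localRep EB F x₀ s =ᶠ[𝓝 (φ p)] 0 := by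
      have h1 : Filter.Tendsto φ.symm (𝓝 (φ p)) (𝓝 p) := by
        have h2 := φ.continuousAt_symm (φ.map_source hp1)
        rwa [ContinuousAt, φ.left_inv hp1] at h2
      filter_upwards [h1.eventually hpU] with z hz
      change trivAt F E x₀ (φ.symm z) (s (φ.symm z)) = 0
      rw [hz, map_zero]
    have hEq := ((analyticOnNhd_localRep s x₀).mono hball).eqOn_zero_of_preconnected_of_eventuallyEq_zero
      (convex_ball (φ x₀) r).isPreconnected hp2 hz
    refine Filter.mem_of_superset hV fun q hq => ?_
    have h2 := hEq hq.2
    have h3 := hball hq.2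
    change trivAt F E x₀ (φ.symm (φ q)) (s (φ.symm (φ q))) = 0 at h2
    have h4 := (map_eq_zero_iff _ (trivAt_injective h3.2)).1 h2
    rwa [φ.left_inv hq.1] at h4
  have huniv : U = univ := IsClopen.eq_univ ⟨hUc, hUo⟩ ⟨x, h⟩
  exact Filter.Eventually.self_of_nhds (p := fun y => s y = 0) (huniv ▸ mem_univ y : y ∈ U)

/-- Coordinate changes are continuous in operator norm, hence locally bounded, and compactness makes
the bound uniform. This compares the fibre norms of different trivializations; the index `i` may
vary with the point. -/
theorem exists_bound_trivAt {ι : Type*} {K : Set X} (hK : IsCompact K) (x₀ : X)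
    (hKs : K ⊆ (trivializationAt F E x₀).baseSet) (t : Set ι) (c : ι → X) (V : ι → Set X)
    (hVo : ∀ i ∈ t, IsOpen (V i)) (hVs : ∀ i ∈ t, V i ⊆ (trivializationAt F E (c i)).baseSet)
    (hcov : K ⊆ ⋃ i ∈ t, V i) :
    ∃ C : ℝ, ∀ p ∈ K, ∃ i ∈ t, p ∈ V i ∧
      ∀ v : E p, ‖trivAt F E x₀ p v‖ ≤ C * ‖trivAt F E (c i) p v‖ := by
  refine hK.induction_on (p := fun S => ∃ C : ℝ, ∀ p ∈ S, ∃ i ∈ t, p ∈ V i ∧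
      ∀ v : E p, ‖trivAt F E x₀ p v‖ ≤ C * ‖trivAt F E (c i) p v‖) ⟨0, by simp⟩
    (fun A B hAB ⟨C, hC⟩ => ⟨C, fun p hp => hC p (hAB hp)⟩) ?_ ?_
  · rintro A B ⟨C, hC⟩ ⟨D, hD⟩
    refine ⟨max C D, fun p hp => ?_⟩
    rcases hp with hp | hp
    · obtain ⟨i, hi, hpi, h⟩ := hC p hp
      exact ⟨i, hi, hpi, fun v => (h v).trans (by gcongr; exact le_max_left _ _)⟩
    · obtain ⟨i, hi, hpi, h⟩ := hD p hp
      exact ⟨i, hi, hpi, fun v => (h v).trans (by gcongr; exact le_max_right _ _)⟩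
  · intro p hp
    obtain ⟨i, hi, hpi⟩ : ∃ i ∈ t, p ∈ V i := by simpa using hcov hp
    let g : X → F →L[ℂ] F := fun b =>
      (Trivialization.coordChangeL ℂ (trivializationAt F E (c i)) (trivializationAt F E x₀) b :
        F →L[ℂ] F)
    have hmem : p ∈ (trivializationAt F E (c i)).baseSet ∩ (trivializationAt F E x₀).baseSet :=
      ⟨hVs i hi hpi, hKs hp⟩
    have hopen := (trivializationAt F E (c i)).open_baseSet.inter
      (trivializationAt F E x₀).open_baseSet
    have hg : ContinuousAt g p :=
      (continuousOn_coordChange ℂ (trivializationAt F E (c i))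
        (trivializationAt F E x₀)).continuousAt (hopen.mem_nhds hmem)
    have hev : ∀ᶠ q in 𝓝 p, ‖g q‖ < ‖g p‖ + 1 :=
      hg.norm.eventually (gt_mem_nhds (lt_add_one _))
    refine ⟨_, mem_nhdsWithin_of_mem_nhds (Filter.inter_mem hev
      (Filter.inter_mem ((hVo i hi).mem_nhds hpi) (hopen.mem_nhds hmem))), ‖g p‖ + 1, ?_⟩
    rintro q ⟨hq1, hq2, hq3⟩
    refine ⟨i, hi, hq2, fun v => ?_⟩
    have h1 : trivAt F E x₀ q v = g q (trivAt F E (c i) q v) := by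
      change _ = Trivialization.coordChangeL ℂ (trivializationAt F E (c i))
        (trivializationAt F E x₀) q _
      rw [Trivialization.coordChangeL_apply _ _ hq3, trivAt, trivAt,
        Trivialization.coe_linearMapAt_of_mem _ hq3.1, Trivialization.coe_linearMapAt_of_mem _ hq3.2]
      simp only [Trivialization.symm_apply_apply_mk _ hq3.1]
    rw [h1]
    exact ((g q).le_opNorm _).trans (by gcongr; exact hq1.le)

/-- On a compact complex manifold, a holomorphic section is determined by its values at finitely
many points. -/
theorem exists_finite_points [FiniteDimensional ℂ EB] [CompactSpace X] [IsManifold 𝓘(ℂ, EB) ω X]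
    [ContMDiffVectorBundle ω F E 𝓘(ℂ, EB)] :
    ∃ P : Set X, P.Finite ∧ ∀ s : HolSections EB F E, (∀ p ∈ P, s p = 0) → s = 0 := by
  have hproper : ProperSpace EB := FiniteDimensional.proper ℂ EB
  -- The radius is doubled so that a ball of radius `r x` about any point of the ball of radius `r
  -- x` stays in the domain.
  have hr : ∀ x : X, ∃ r > 0, closedBall (chartAt EB x x) (2 * r) ⊆ chartDomain EB F E x := by
    intro x
    obtain ⟨ε, hε, h⟩ := Metric.nhds_basis_closedBall.mem_iff.1
      ((isOpen_chartDomain (EB := EB) (F := F) (E := E) x).mem_nhds (mem_chartDomain_self x))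
    exact ⟨ε / 2, half_pos hε, by rwa [mul_div_cancel₀ ε two_ne_zero]⟩
  choose r hr0 hr using hr
  let V : X → Set X := fun x => (chartAt EB x).source ∩ chartAt EB x ⁻¹' ball (chartAt EB x x) (r x)
  have hVo : ∀ x, IsOpen (V x) := fun x => (chartAt EB x).isOpen_inter_preimage isOpen_ball
  have hball : ∀ x, ball (chartAt EB x x) (r x) ⊆ closedBall (chartAt EB x x) (2 * r x) := fun x =>
    (ball_subset_closedBall).trans (closedBall_subset_closedBall (by linarith [hr0 x]))
  have hVs : ∀ x, V x ⊆ (trivializationAt F E x).baseSet := by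
    intro x p hp
    have := (hr x (hball x hp.2)).2
    rwa [mem_preimage, (chartAt EB x).left_inv hp.1] at this
  obtain ⟨t, ht⟩ := isCompact_univ.elim_finite_subcover V hVo
    (fun x _ => mem_iUnion.2 ⟨x, mem_chart_source EB x, mem_ball_self (hr0 x)⟩)
  let K : X → Set X := fun x => (chartAt EB x).symm '' closedBall (chartAt EB x x) (2 * r x)
  have hK : ∀ x, IsCompact (K x) := fun x =>
    (isCompact_closedBall _ _).image_of_continuousOn
      ((chartAt EB x).continuousOn_symm.mono fun z hz => (hr x hz).1)
  have hKs : ∀ x, K x ⊆ (trivializationAt F E x).baseSet := by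
    rintro x _ ⟨z, hz, rfl⟩
    exact (hr x hz).2
  have hVK : ∀ x, V x ⊆ K x := fun x p hp =>
    ⟨chartAt EB x p, hball x hp.2, (chartAt EB x).left_inv hp.1⟩
  have hbd := fun x => exists_bound_trivAt (hK x) x (hKs x) (t : Set X) id V
    (fun i _ => hVo i) (fun i _ => hVs i) ((subset_univ _).trans (by simpa using ht))
  choose C hC using hbd
  -- The bound `r x` keeps nearby points within reach of the Schwarz lemma; the other bound turns
  -- its estimate into `M / 4`. Passing to `|C x| + 1` ensures a positive divisor.
  let δ : X → ℝ := fun x => min (r x) (r x / (4 * (|C x| + 1)))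
  have hδ : ∀ x, 0 < δ x := fun x => lt_min (hr0 x) (div_pos (hr0 x) (by positivity))
  have happ := fun x => Metric.finite_approx_of_totallyBounded
    ((isCompact_closedBall (chartAt EB x x) (2 * r x)).totallyBounded.subset (hball x)) (δ x) (hδ x)
  choose Q hQs hQf hQc using happ
  refine ⟨⋃ x ∈ t, (chartAt EB x).symm '' Q x,
    t.finite_toSet.biUnion fun x _ => (hQf x).image _, fun s hs => ?_⟩
  let S : Set ℝ := ⋃ x ∈ t, (fun p => ‖trivAt F E x p (s p)‖) '' V x
  have hSbdd : BddAbove S := by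
    refine (Set.Finite.bddAbove_biUnion t.finite_toSet).2 fun x _ => ?_
    exact ((hK x).bddAbove_image
      ((contMDiffOn_trivAt s x).continuousOn.mono (hKs x)).norm).mono (image_mono (hVK x))
  let M := sSup S
  have hM : ∀ x ∈ t, ∀ p ∈ V x, ‖trivAt F E x p (s p)‖ ≤ M := fun x hx p hp =>
    le_csSup hSbdd (mem_biUnion hx ⟨p, hp, rfl⟩)
  have hM0 : 0 ≤ M := Real.sSup_nonneg fun y hy => by
    simp only [S, mem_iUnion] at hy
    obtain ⟨x, _, p, _, rfl⟩ := hy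
    exact norm_nonneg _
  -- The supremum `M` only controls the small sets `V i`; the comparison of trivializations carries
  -- the bound to the larger balls.
  have hKM : ∀ x, ∀ z ∈ closedBall (chartAt EB x x) (2 * r x),
      ‖localRep EB F x s z‖ ≤ (|C x| + 1) * M := by
    intro x z hz
    obtain ⟨i, hi, hpi, h⟩ := hC x _ ⟨z, hz, rfl⟩
    refine (h _).trans ?_
    have h1 := hM i hi _ hpi
    have h2 := le_abs_self (C x)
    calc _ ≤ (|C x| + 1) * ‖trivAt F E i ((chartAt EB x).symm z) (s ((chartAt EB x).symm z))‖ :=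
          mul_le_mul_of_nonneg_right (by linarith) (norm_nonneg _)
      _ ≤ _ := by gcongr
  have hhalf : ∀ y ∈ S, y ≤ M / 2 := by
    intro y hy
    simp only [S, mem_iUnion] at hy
    obtain ⟨x, hx, p, hp, rfl⟩ := hy
    obtain ⟨q, hq, hpq⟩ : ∃ q ∈ Q x, chartAt EB x p ∈ ball q (δ x) := by
      simpa using hQc x hp.2
    have hsub : ball q (r x) ⊆ closedBall (chartAt EB x x) (2 * r x) := by
      intro w hw
      have h1 : dist w q < r x := hw
      have h2 : dist q (chartAt EB x x) < r x := hQs x hq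
      have := dist_triangle w q (chartAt EB x x)
      rw [mem_closedBall]; linarith
    have hq0 : localRep EB F x s q = 0 := by
      change trivAt F E x _ (s _) = 0
      rw [hs _ (mem_biUnion hx ⟨q, hq, rfl⟩), map_zero]
    have hmaps : MapsTo (localRep EB F x s) (ball q (r x))
        (closedBall (localRep EB F x s q) ((|C x| + 1) * M)) := by
      intro w hw
      rw [hq0, mem_closedBall_zero_iff]
      exact hKM x w (hsub hw)
    -- Schwarz lemma on the ball about `q`, a zero of `s` within `δ x` of the point considered.
    have hmain := Complex.dist_le_div_mul_dist_of_mapsTo_ball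
      ((analyticOnNhd_localRep s x).mono (hsub.trans (hr x))).differentiableOn hmaps
      (ball_subset_ball (min_le_left _ _) hpq)
    rw [hq0, dist_zero_right] at hmain
    have h3 : localRep EB F x s (chartAt EB x p) = trivAt F E x p (s p) := by
      change trivAt F E x ((chartAt EB x).symm _) (s ((chartAt EB x).symm _)) = _
      rw [(chartAt EB x).left_inv hp.1]
    have h4 : dist (chartAt EB x p) q ≤ r x / (4 * (|C x| + 1)) :=
      (le_of_lt hpq).trans (min_le_right _ _)
    have h5 := hr0 x
    have h6 : 0 < |C x| + 1 := by positivity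
    rw [h3] at hmain
    calc _ ≤ _ := hmain
      _ ≤ (|C x| + 1) * M / r x * (r x / (4 * (|C x| + 1))) := by gcongr
      _ = M / 4 := by field_simp
      _ ≤ M / 2 := by linarith
  have hM' : M ≤ M / 2 := Real.sSup_le hhalf (by linarith)
  have hM0' : M ≤ 0 := by linarith
  ext p
  obtain ⟨x, hx, hp⟩ : ∃ x ∈ t, p ∈ V x := by simpa using ht (mem_univ p)
  have h1 := norm_le_zero_iff.1 ((hM x hx p hp).trans hM0')
  exact (map_eq_zero_iff _ (trivAt_injective (hVs x hp))).1 h1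

instance finiteDimensional [FiniteDimensional ℂ EB] [FiniteDimensional ℂ F] [CompactSpace X]
    [IsManifold 𝓘(ℂ, EB) ω X] [ContMDiffVectorBundle ω F E 𝓘(ℂ, EB)] :
    FiniteDimensional ℂ (HolSections EB F E) := by
  obtain ⟨P, hP, h⟩ := exists_finite_points (EB := EB) (F := F) (E := E)
  have := hP.to_subtype
  have : ∀ x, FiniteDimensional ℂ (E x) := finiteDimensional_fiber (F := F)
  refine FiniteDimensional.of_injective
    (LinearMap.pi fun p : P => evalAt EB F E (p : X)) ?_
  refine (injective_iff_map_eq_zero _).2 fun s hs => h s fun p hp => ?_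
  exact congrFun hs ⟨p, hp⟩

/-- A finite system of points `p a`, forms `ζ a` on the fibres over them, and sections `s a`, such
that every linear form `σ` on the space of sections is `∑ a, σ (s a) • (ζ a ∘ ev (p a))`. -/
structure EvalFrame (EB : Type*) [NormedAddCommGroup EB] [NormedSpace ℂ EB] (F : Type*)
    [NormedAddCommGroup F] [NormedSpace ℂ F] {X : Type*} [TopologicalSpace X] [ChartedSpace EB X]
    (E : X → Type*) [TopologicalSpace (TotalSpace F E)] [∀ x, TopologicalSpace (E x)]
    [∀ x, AddCommGroup (E x)] [∀ x, Module ℂ (E x)] [FiberBundle F E] [VectorBundle ℂ F E] where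
  /-- The size of the frame. -/
  card : ℕ
  /-- The points of the frame. -/
  pt : Fin card → X
  /-- The forms of the frame. -/
  form : ∀ a, Module.Dual ℂ (E (pt a))
  /-- The sections of the frame. -/
  sec : Fin card → HolSections EB F E
  expand : ∀ σ : Module.Dual ℂ (HolSections EB F E),
    σ = ∑ a, σ (sec a) • (form a ∘ₗ evalAt EB F E (pt a))

/-- A section annihilated by every evaluation form has only zero values, so these forms span the
dual and contain a basis of it. -/
theorem nonempty_evalFrame [FiniteDimensional ℂ EB] [FiniteDimensional ℂ F] [CompactSpace X]
    [IsManifold 𝓘(ℂ, EB) ω X] [ContMDiffVectorBundle ω F E 𝓘(ℂ, EB)] :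
    Nonempty (EvalFrame EB F E) := by
  let D : Set (Module.Dual ℂ (HolSections EB F E)) :=
    range fun q : Σ x, Module.Dual ℂ (E x) => q.2 ∘ₗ evalAt EB F E q.1
  have hD : ⊤ ≤ Submodule.span ℂ D := by
    have h0 : (Submodule.span ℂ D).dualCoannihilator = ⊥ := by
      refine eq_bot_iff.2 fun s hs => ?_
      rw [Submodule.mem_bot]
      ext x
      have := finiteDimensional_fiber (F := F) (E := E) x
      refine (Module.forall_dual_apply_eq_zero_iff ℂ (s x)).1 fun ξ => ?_
      exact (Submodule.mem_dualCoannihilator _).1 hs _ (Submodule.subset_span ⟨⟨x, ξ⟩, rfl⟩)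
    rw [← Subspace.dualCoannihilator_dualAnnihilator_eq (W := Submodule.span ℂ D), h0,
      Submodule.dualAnnihilator_bot]
  let b₀ := Module.Basis.ofSpan hD
  have hfin := Module.Finite.finite_basis b₀
  let b := b₀.reindex (Finite.equivFin _)
  have hb : ∀ a, ∃ q : Σ x, Module.Dual ℂ (E x), q.2 ∘ₗ evalAt EB F E q.1 = b a := fun a =>
    Module.Basis.ofSpan_subset hD ⟨(Finite.equivFin _).symm a, (b₀.reindex_apply _ a).symm⟩
  choose q hq using hb
  -- The sections are the basis dual to `b`, under the identification of `𝒪(E)` with its bidual.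
  refine ⟨⟨_, fun a => (q a).1, fun a => (q a).2,
    fun a => (Module.evalEquiv ℂ (HolSections EB F E)).symm (b.coord a), fun σ => ?_⟩⟩
  simp only [hq, Module.apply_evalEquiv_symm_apply]
  exact (b.sum_repr σ).symm

end HolSections

/-! ### Linear forms on `A ⊗ B̄` -/

section TensorForms

variable {A B : Type*} [AddCommGroup A] [Module ℂ A] [AddCommGroup B] [Module ℂ B]

namespace ConjSpace

instance finiteDimensional [FiniteDimensional ℂ A] : FiniteDimensional ℂ (ConjSpace A) :=
  Module.Finite.of_surjective (toConj A) fun v => ⟨ofConj A v, rfl⟩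

theorem exists_conjForm_eq (ζ : Module.Dual ℂ (ConjSpace A)) :
    ∃ η : Module.Dual ℂ A, conjForm η = ζ :=
  ⟨{ toFun := fun v => conj (ζ (toConj A v))
     map_add' := fun v w => by simp
     map_smul' := fun c v => by simp }, by ext v; exact Complex.conj_conj _⟩

end ConjSpace

open ConjSpace

theorem formTensorConj_tensorFlip (ξ : Module.Dual ℂ A) (η : Module.Dual ℂ B)
    (u : A ⊗[ℂ] ConjSpace B) :
    formTensorConj η ξ (tensorFlip A B u) = conj (formTensorConj ξ η u) := by
  induction u with
  | zero => simp
  | add u v hu hv => simp only [map_add, hu, hv]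
  | tmul a b =>
    change η (ofConj B b) * conj (ξ a) = conj (ξ a * conj (η (ofConj B b)))
    rw [map_mul, Complex.conj_conj, mul_comm]

theorem formTensorConj_map {A' B' : Type*} [AddCommGroup A'] [Module ℂ A'] [AddCommGroup B']
    [Module ℂ B'] (f : A →ₗ[ℂ] A') (g : B →ₗ[ℂ] B') (ξ : Module.Dual ℂ A') (η : Module.Dual ℂ B')
    (u : A ⊗[ℂ] ConjSpace B) :
    formTensorConj ξ η (TensorProduct.map f (ConjSpace.map g) u) =
      formTensorConj (ξ ∘ₗ f) (η ∘ₗ g) u := by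
  induction u with
  | zero => simp
  | add u v hu hv => simp only [map_add, hu, hv]
  | tmul a b => rfl

/-- Forms on a tensor product of finite dimensional spaces are sums of elementary ones, and every
form on `B̄` is some `η̄`. This reduces an arbitrary component `l` of a kernel to products of a
holomorphic and an antiholomorphic factor. -/
theorem exists_eq_sum_formTensorConj [FiniteDimensional ℂ A] [FiniteDimensional ℂ B]
    (l : Module.Dual ℂ (A ⊗[ℂ] ConjSpace B)) :
    ∃ (n : ℕ) (ξ : Fin n → Module.Dual ℂ A) (η : Fin n → Module.Dual ℂ B),
      l = ∑ i, formTensorConj (ξ i) (η i) := by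
  obtain ⟨t, rfl⟩ := (TensorProduct.dualDistribEquiv ℂ A (ConjSpace B)).surjective l
  induction t with
  | zero => exact ⟨0, Fin.elim0, Fin.elim0, by simp⟩
  | tmul ξ ζ =>
    obtain ⟨η, rfl⟩ := exists_conjForm_eq ζ
    exact ⟨1, fun _ => ξ, fun _ => η, by simp [formTensorConj, TensorProduct.dualDistribEquiv]; rfl⟩
  | add u v hu hv =>
    obtain ⟨n, ξ, η, h⟩ := hu
    obtain ⟨m, ξ', η', h'⟩ := hv
    refine ⟨n + m, Fin.append ξ ξ', Fin.append η η', ?_⟩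
    rw [map_add, h, h', Fin.sum_univ_add]
    simp

theorem eq_of_formTensorConj_eq [FiniteDimensional ℂ A] [FiniteDimensional ℂ B]
    {u v : A ⊗[ℂ] ConjSpace B}
    (h : ∀ (ξ : Module.Dual ℂ A) (η : Module.Dual ℂ B), formTensorConj ξ η u = formTensorConj ξ η v) :
    u = v := by
  rw [← sub_eq_zero, ← Module.forall_dual_apply_eq_zero_iff ℂ]
  intro l
  obtain ⟨n, ξ, η, rfl⟩ := exists_eq_sum_formTensorConj l
  simp [h]

/-- Contraction of the second factor with the form `η̄`. -/
def contractConj (A : Type*) [AddCommGroup A] [Module ℂ A] (η : Module.Dual ℂ B) :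
    A ⊗[ℂ] ConjSpace B →ₗ[ℂ] A :=
  (TensorProduct.rid ℂ A).toLinearMap ∘ₗ (conjForm η).lTensor A

theorem apply_contractConj (ξ : Module.Dual ℂ A) (η : Module.Dual ℂ B) (u : A ⊗[ℂ] ConjSpace B) :
    ξ (contractConj A η u) = formTensorConj ξ η u := by
  induction u with
  | zero => simp
  | add u v hu hv => simp only [map_add, hu, hv]
  | tmul a b =>
    change ξ (conj (η (ofConj B b)) • a) = _
    rw [map_smul, smul_eq_mul, mul_comm]
    rfl

end TensorForms

/-! ### Conjugates and components of holomorphic functions -/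

section Smoothness

open ConjSpace

/-- Conjugating the terms of the power series of `f` gives maps that are complex multilinear on the
conjugate space and obey the same norm bounds, so the radius of convergence does not drop. -/
theorem AnalyticAt.conj_comp_ofConj {V : Type*} [NormedAddCommGroup V] [NormedSpace ℂ V]
    {f : V → ℂ} {z : V} (hf : AnalyticAt ℂ f z) :
    AnalyticAt ℂ (fun w : ConjSpace V => conj (f (ofConj V w))) (toConj V z) := by
  obtain ⟨p, r, hp⟩ := hf
  let q₀ : ∀ n, MultilinearMap ℂ (fun _ : Fin n => ConjSpace V) ℂ := fun n =>
    { toFun := fun v => conj (p n fun i => ofConj V (v i))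
      map_update_add' := fun v i x y => by
        have h : ∀ x, (fun j => ofConj V (Function.update v i x j)) =
            Function.update (fun j => ofConj V (v j)) i (ofConj V x) := fun x => by
          ext j; rcases eq_or_ne j i with rfl | hj <;> simp_all
        simp only [h, map_add, ContinuousMultilinearMap.map_update_add]
      map_update_smul' := fun v i c x => by
        have h : ∀ x, (fun j => ofConj V (Function.update v i x j)) =
            Function.update (fun j => ofConj V (v j)) i (ofConj V x) := fun x => by
          ext j; rcases eq_or_ne j i with rfl | hj <;> simp_all
        simp only [h, LinearMap.map_smulₛₗ, ContinuousMultilinearMap.map_update_smul]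
        simp }
  have hq₀ : ∀ n v, ‖q₀ n v‖ ≤ ‖p n‖ * ∏ i, ‖v i‖ := fun n v => by
    change ‖conj (p n fun i => ofConj V (v i))‖ ≤ _
    rw [RCLike.norm_conj]
    exact (p n).le_opNorm _
  let q : FormalMultilinearSeries ℂ (ConjSpace V) ℂ := fun n => (q₀ n).mkContinuous _ (hq₀ n)
  refine ⟨q, r, ?_, hp.r_pos, fun {y} hy => ?_⟩
  · refine hp.r_le.trans (FormalMultilinearSeries.radius_le_of_le fun n => ?_)
    exact MultilinearMap.mkContinuous_norm_le _ (norm_nonneg _) _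
  · exact Complex.hasSum_conj'.2 (hp.hasSum hy)

variable {EB : Type*} [NormedAddCommGroup EB] [NormedSpace ℂ EB]
  {X : Type*} [TopologicalSpace X] [ChartedSpace EB X]

theorem ContMDiffOn.conj_conjModel {f : X → ℂ} {s : Set X} (hs : IsOpen s)
    (hf : ContMDiffOn 𝓘(ℂ, EB) 𝓘(ℂ, ℂ) ω f s) :
    ContMDiffOn (conjModel EB) 𝓘(ℂ, ℂ) ω (fun x => conj (f x)) s := by
  intro x hx
  have h := contMDiffAt_iff.1 (hf.contMDiffAt (hs.mem_nhds hx))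
  refine (contMDiffAt_iff.2 ⟨Complex.continuous_conj.continuousAt.comp h.1, ?_⟩).contMDiffWithinAt
  have h2 := h.2
  simp only [mfld_simps, contDiffWithinAt_univ] at h2
  have hr : Set.range (conjModel EB) = Set.univ := Set.range_eq_univ.2 fun v => ⟨v, rfl⟩
  rw [hr, contDiffWithinAt_univ]
  exact (AnalyticAt.conj_comp_ofConj (h2.analyticAt)).contDiffAt

theorem ContMDiffOn.realSmooth {f : X → ℂ} {s : Set X}
    (hf : ContMDiffOn 𝓘(ℂ, EB) 𝓘(ℂ, ℂ) ω f s) :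
    ContMDiffOn 𝓘(ℝ, EB) 𝓘(ℝ, ℂ) ∞ f s := by
  intro x hx
  have h := contMDiffWithinAt_iff.1 (hf x hx)
  refine contMDiffWithinAt_iff.2 ⟨h.1, ?_⟩
  have h2 := h.2
  simp only [mfld_simps] at h2 ⊢
  exact (h2.restrict_scalars ℝ).of_le le_top

theorem contMDiffOn_of_dual {F : Type*} [NormedAddCommGroup F] [NormedSpace ℂ F]
    [FiniteDimensional ℂ F] {f : X → F} {s : Set X}
    (hf : ∀ ξ : Module.Dual ℂ F, ContMDiffOn 𝓘(ℂ, EB) 𝓘(ℂ, ℂ) ω (fun x => ξ (f x)) s) :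
    ContMDiffOn 𝓘(ℂ, EB) 𝓘(ℂ, F) ω f s := by
  let b := Module.finBasis ℂ F
  have h : ContMDiffOn 𝓘(ℂ, EB) 𝓘(ℂ, F) ω (fun x => ∑ i, b.coord i (f x) • b i) s :=
    contMDiffOn_finsetSum fun i _ => (hf (b.coord i)).smul contMDiffOn_const
  exact h.congr fun x _ => (b.sum_repr (f x)).symm

end Smoothness

/-! ### Kernels `s(x) ⊗ t̄(y)` and slices of holomorphic kernels -/

section KernelSmoothness

open HolSections

variable {EB : Type*} [NormedAddCommGroup EB] [NormedSpace ℂ EB]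
  {F : Type*} [NormedAddCommGroup F] [NormedSpace ℂ F]
  {X : Type*} [TopologicalSpace X] [ChartedSpace EB X]
  {E : X → Type*} [TopologicalSpace (TotalSpace F E)] [∀ x, TopologicalSpace (E x)]
  [∀ x, AddCommGroup (E x)] [∀ x, Module ℂ (E x)] [FiberBundle F E] [VectorBundle ℂ F E]

theorem contMDiffOn_dual_trivAt [ContMDiffVectorBundle ω F E 𝓘(ℂ, EB)] [FiniteDimensional ℂ F]
    (s : HolSections EB F E) (x₀ : X) (ξ : Module.Dual ℂ F) :
    ContMDiffOn 𝓘(ℂ, EB) 𝓘(ℂ, ℂ) ω (fun x => ξ (trivAt F E x₀ x (s x)))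
      (trivializationAt F E x₀).baseSet :=
  (LinearMap.toContinuousLinearMap ξ).contMDiff.comp_contMDiffOn (contMDiffOn_trivAt s x₀)

/-- The kernel `s(x) ⊗ t(y)` of two sections `s`, `t` of `E`. -/
def tensorKernel (s t : ∀ x, E x) (x y : X) : E x ⊗[ℂ] ConjSpace (E y) :=
  s x ⊗ₜ[ℂ] ConjSpace.toConj (E y) (t y)

theorem apply_tensorTriv_tensorKernel {n : ℕ} (ξ η : Fin n → Module.Dual ℂ F) (s t : ∀ x, E x)
    (x₀ y₀ x y : X) :
    (∑ i, formTensorConj (ξ i) (η i)) (tensorTriv F E x₀ y₀ x y (tensorKernel s t x y)) =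
      ∑ i, ξ i (trivAt F E x₀ x (s x)) * conj (η i (trivAt F E y₀ y (t y))) := by
  rw [LinearMap.sum_apply]
  rfl

theorem isHolKernel_tensorKernel [ContMDiffVectorBundle ω F E 𝓘(ℂ, EB)] [FiniteDimensional ℂ F]
    (s t : HolSections EB F E) : IsHolKernel EB F E (tensorKernel s t) := by
  intro x₀ y₀ l
  obtain ⟨n, ξ, η, rfl⟩ := exists_eq_sum_formTensorConj l
  simp only [apply_tensorTriv_tensorKernel]
  refine contMDiffOn_finsetSum fun i _ => ContMDiffOn.mul ?_ ?_
  · exact (contMDiffOn_dual_trivAt s x₀ (ξ i)).comp contMDiffOn_fst fun p hp => hp.1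
  · exact ((contMDiffOn_dual_trivAt t y₀ (η i)).conj_conjModel
      (trivializationAt F E y₀).open_baseSet).comp contMDiffOn_snd fun p hp => hp.2

theorem isSmoothSection_tensorKernel [ContMDiffVectorBundle ω F E 𝓘(ℂ, EB)]
    [FiniteDimensional ℂ F] (s t : HolSections EB F E) :
    IsSmoothSection EB F E fun x => tensorKernel s t x x := by
  intro x₀ l
  obtain ⟨n, ξ, η, rfl⟩ := exists_eq_sum_formTensorConj l
  simp only [apply_tensorTriv_tensorKernel]
  exact contMDiffOn_finsetSum fun i _ => (contDiff_mul (𝕜 := ℝ) (𝔸 := ℂ)).contMDiff.comp_contMDiffOn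
    ((contMDiffOn_dual_trivAt s x₀ (ξ i)).realSmooth.prodMk_space
      (Complex.conjCLE.contDiff.contMDiff.comp_contMDiffOn
        (contMDiffOn_dual_trivAt t x₀ (η i)).realSmooth))

theorem exists_comp_trivAt_eq {y₀ y : X} (hy : y ∈ (trivializationAt F E y₀).baseSet)
    (η : Module.Dual ℂ (E y)) : ∃ η' : Module.Dual ℂ F, η' ∘ₗ trivAt F E y₀ y = η := by
  refine ⟨η ∘ₗ ((trivializationAt F E y₀).linearEquivAt ℂ y hy).symm.toLinearMap, ?_⟩
  ext v
  change η (((trivializationAt F E y₀).linearEquivAt ℂ y hy).symm (trivAt F E y₀ y v)) = η v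
  rw [trivAt, Trivialization.coe_linearMapAt_of_mem _ hy]
  exact congrArg η (((trivializationAt F E y₀).linearEquivAt ℂ y hy).symm_apply_apply v)

/-- The holomorphic section `x ↦ (id ⊗ η̄) L(x, y)`. -/
def IsHolKernel.contract [ContMDiffVectorBundle ω F E 𝓘(ℂ, EB)] [FiniteDimensional ℂ F]
    {L : ∀ x y : X, E x ⊗[ℂ] ConjSpace (E y)} (hL : IsHolKernel EB F E L) (y : X)
    (η : Module.Dual ℂ (E y)) : HolSections EB F E where
  toFun x := contractConj (E x) η (L x y)
  contMDiff_toFun := by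
    intro x₀
    have hx₀ := (trivializationAt F E x₀).open_baseSet.mem_nhds
      (mem_baseSet_trivializationAt F E x₀)
    refine ContMDiffOn.contMDiffAt ?_ hx₀
    refine (contMDiffOn_trivAt_iff (fun x => contractConj (E x) η (L x y)) x₀).2
      (contMDiffOn_of_dual fun ξ => ?_)
    have hy := mem_baseSet_trivializationAt F E y
    obtain ⟨η', hη⟩ := exists_comp_trivAt_eq (F := F) hy η
    -- With `η` read as `η'` in the trivialization at `y`, the `ξ` component of the contraction is
    -- the `ξ ⊗ η̄'` component of `L` on the slice `X × {y}`.
    have h := (hL x₀ y (formTensorConj ξ η')).comp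
      ((contMDiff_id (I := 𝓘(ℂ, EB)) (M := X)).prodMk
        (contMDiff_const (I' := conjModel EB) (c := y))).contMDiffOn
      (s := (trivializationAt F E x₀).baseSet) (fun x hx => ⟨hx, hy⟩)
    refine h.congr fun x _ => ?_
    change (ξ ∘ₗ trivAt F E x₀ x) _ = formTensorConj ξ η' (tensorTriv F E x₀ y x y (L x y))
    rw [apply_contractConj, tensorTriv, formTensorConj_map, hη]

theorem IsHolKernel.apply_contract [ContMDiffVectorBundle ω F E 𝓘(ℂ, EB)] [FiniteDimensional ℂ F]
    {L : ∀ x y : X, E x ⊗[ℂ] ConjSpace (E y)} (hL : IsHolKernel EB F E L) (x y : X)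
    (ξ : Module.Dual ℂ (E x)) (η : Module.Dual ℂ (E y)) :
    ξ (hL.contract y η x) = formTensorConj ξ η (L x y) :=
  apply_contractConj ξ η (L x y)

end KernelSmoothness

/-! ### Continuity of finite separated sums for uniform convergence -/

section UniformOnFunSums

/-- On each `C` the difference of two values of `Φ` is at most `∑ ‖c i h₀ - c i h‖ * M i`, uniformly
in the point. The expansion is required only on the sets of `𝔖`, since for derivatives it is
available only inside a chart domain. -/
theorem UniformOnFun.continuous_ofFun_of_eq_sum {H α G ι : Type*} [TopologicalSpace H]
    [NormedAddCommGroup G] [NormedSpace ℂ G] {𝔖 : Set (Set α)} (t : Finset ι) (Φ : H → α → G)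
    (c : ι → H → ℂ) (g : ι → α → G) (hc : ∀ i, Continuous (c i))
    (hg : ∀ C ∈ 𝔖, ∀ i, ∃ M, ∀ p ∈ C, ‖g i p‖ ≤ M)
    (hΦ : ∀ C ∈ 𝔖, ∀ p ∈ C, ∀ h, Φ h p = ∑ i ∈ t, c i h • g i p) :
    Continuous fun h => UniformOnFun.ofFun 𝔖 (Φ h) := by
  refine continuous_iff_continuousAt.2 fun h₀ =>
    UniformOnFun.tendsto_iff_tendstoUniformlyOn.2 fun C hC => ?_
  choose M hM using hg C hC
  refine Metric.tendstoUniformlyOn_iff.2 fun ε hε => ?_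
  have hcont : Continuous fun h => ∑ i ∈ t, ‖c i h₀ - c i h‖ * M i :=
    continuous_finsetSum _ fun i _ => ((continuous_const.sub (hc i)).norm).mul continuous_const
  have h0 : ∑ i ∈ t, ‖c i h₀ - c i h₀‖ * M i < ε := by simpa using hε
  filter_upwards [hcont.continuousAt.eventually (gt_mem_nhds h0)] with h hh p hp
  refine lt_of_le_of_lt ?_ hh
  change dist (Φ h₀ p) (Φ h p) ≤ _
  rw [dist_eq_norm, hΦ C hC p hp, hΦ C hC p hp, ← Finset.sum_sub_distrib]
  refine (norm_sum_le _ _).trans (Finset.sum_le_sum fun i _ => ?_)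
  rw [← sub_smul, norm_smul]
  gcongr
  exact hM i p hp

end UniformOnFunSums

/-! ### The space of inner products and its Gram matrices -/

namespace InnerProducts

variable {W : Type*} [AddCommGroup W] [Module ℂ W]

/-- An inner product, as a function of two variables. -/
def toPi (W : Type*) [AddCommGroup W] [Module ℂ W] : InnerProducts W →ₗ[ℝ] (W × W → ℂ) where
  toFun h p := h.1 p.1 p.2
  map_add' _ _ := rfl
  map_smul' _ _ := rfl

theorem ext_apply {g h : InnerProducts W} (H : ∀ σ τ, g.1 σ τ = h.1 σ τ) : g = h :=
  Subtype.ext (LinearMap.ext fun σ => LinearMap.ext fun τ => H σ τ)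

theorem toPi_injective : Function.Injective (toPi W) := fun _ _ hgh =>
  ext_apply fun σ τ => congrFun hgh (σ, τ)

theorem continuous_toPi : Continuous (toPi W) := continuous_induced_dom

theorem continuous_apply (σ τ : W) : Continuous fun h : InnerProducts W => h.1 σ τ :=
  (_root_.continuous_apply (σ, τ)).comp continuous_toPi

instance : IsTopologicalAddGroup (InnerProducts W) := topologicalAddGroup_induced (toPi W)

instance : ContinuousSMul ℝ (InnerProducts W) := continuousSMul_induced (toPi W)

instance : T2Space (InnerProducts W) := T2Space.of_injective_continuous toPi_injective continuous_toPi

end InnerProducts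

namespace InnerProducts

variable {W : Type*} [AddCommGroup W] [Module ℂ W] (h : InnerProducts W)

open scoped Matrix

/-- The coefficients are conjugated because `h` is linear in its first variable, whereas the
quadratic form of a matrix conjugates the left vector. -/
theorem apply_sum_smul {n : ℕ} (σ : Fin n → W) (c : Fin n → ℂ) :
    h.1 (∑ i, conj (c i) • σ i) (∑ i, conj (c i) • σ i) =
      star c ⬝ᵥ ((Matrix.of fun i j => h.1 (σ i) (σ j)) *ᵥ c) := by
  simp only [map_sum, LinearMap.sum_apply, LinearMap.map_smulₛₗ, LinearMap.smul_apply, smul_eq_mul,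
    dotProduct, Matrix.mulVec, Matrix.of_apply, Pi.star_apply, Finset.mul_sum, Complex.conj_conj,
    RingHom.id_apply]
  rw [Finset.sum_comm]
  refine Finset.sum_congr rfl fun i _ => Finset.sum_congr rfl fun j _ => ?_
  change _ = conj (c i) * _
  ring

theorem posSemidef_gram {n : ℕ} (hpos : IsPosSemidef h) (σ : Fin n → W) :
    (Matrix.of fun i j => h.1 (σ i) (σ j)).PosSemidef := by
  refine .of_dotProduct_mulVec_nonneg (Matrix.ext fun i j => (h.2 _ _).symm) fun c => ?_
  rw [← apply_sum_smul]
  exact Complex.nonneg_iff.2 ⟨hpos _, (Complex.conj_eq_iff_im.1 (h.2 _ _).symm).symm⟩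

end InnerProducts

/-! ### Bergman kernels in a frame and the inverse of `B` -/

namespace HolSections.EvalFrame

open HolSections

variable {EB : Type*} [NormedAddCommGroup EB] [NormedSpace ℂ EB]
  {F : Type*} [NormedAddCommGroup F] [NormedSpace ℂ F]
  {X : Type*} [TopologicalSpace X] [ChartedSpace EB X]
  {E : X → Type*} [TopologicalSpace (TotalSpace F E)] [∀ x, TopologicalSpace (E x)]
  [∀ x, AddCommGroup (E x)] [∀ x, Module ℂ (E x)] [FiberBundle F E] [VectorBundle ℂ F E]
  (fr : EvalFrame EB F E)

/-- The linear form `ζ a ∘ ev (p a)` on sections. -/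
def ev (a : Fin fr.card) : Module.Dual ℂ (HolSections EB F E) :=
  fr.form a ∘ₗ evalAt EB F E (fr.pt a)

theorem apply_eq_sum (σ : Module.Dual ℂ (HolSections EB F E)) (s : HolSections EB F E) :
    σ s = ∑ a, σ (fr.sec a) * fr.form a (s (fr.pt a)) := by
  conv_lhs => rw [fr.expand σ]
  simp [evalAt]

theorem inner_eq_sum (h : InnerProducts (Module.Dual ℂ (HolSections EB F E)))
    (σ τ : Module.Dual ℂ (HolSections EB F E)) :
    h.1 σ τ = ∑ q : Fin fr.card × Fin fr.card,
      h.1 (fr.ev q.1) (fr.ev q.2) * (σ (fr.sec q.1) * conj (τ (fr.sec q.2))) := by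
  conv_lhs => rw [fr.expand σ, fr.expand τ]
  simp only [map_sum, LinearMap.sum_apply, LinearMap.map_smulₛₗ, LinearMap.smul_apply,
    Fintype.sum_prod_type, smul_eq_mul, RingHom.id_apply]
  simp only [Finset.mul_sum]
  rw [Finset.sum_comm]
  refine Finset.sum_congr rfl fun a _ => Finset.sum_congr rfl fun b _ => ?_
  change _ * (_ * h.1 (fr.ev a) (fr.ev b)) = _
  ring

theorem finiteDimensional_innerProducts (fr : EvalFrame EB F E) :
    FiniteDimensional ℝ (InnerProducts (Module.Dual ℂ (HolSections EB F E))) := by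
  refine FiniteDimensional.of_injective
    ((LinearMap.funLeft ℝ ℂ fun q : Fin fr.card × Fin fr.card => (fr.ev q.1, fr.ev q.2)) ∘ₗ
      InnerProducts.toPi _) fun g h hgh => InnerProducts.ext_apply fun σ τ => ?_
  rw [fr.inner_eq_sum g, fr.inner_eq_sum h]
  refine Finset.sum_congr rfl fun q _ => ?_
  rw [show g.1 (fr.ev q.1) (fr.ev q.2) = h.1 (fr.ev q.1) (fr.ev q.2) from congrFun hgh q]

/-- The Bergman kernel, computed in a frame. -/
def kernel (h : InnerProducts (Module.Dual ℂ (HolSections EB F E))) (x y : X) :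
    E x ⊗[ℂ] ConjSpace (E y) :=
  ∑ q : Fin fr.card × Fin fr.card,
    h.1 (fr.ev q.1) (fr.ev q.2) • tensorKernel (fr.sec q.1) (fr.sec q.2) x y

theorem kernel_add (g h : InnerProducts (Module.Dual ℂ (HolSections EB F E))) :
    fr.kernel (g + h) = fr.kernel g + fr.kernel h := by
  ext x y
  simp [kernel, add_smul, Finset.sum_add_distrib]

theorem kernel_smul (r : ℝ) (h : InnerProducts (Module.Dual ℂ (HolSections EB F E))) :
    fr.kernel (r • h) = r • fr.kernel h := by
  ext x y
  change _ = r • fr.kernel h x y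
  rw [← algebraMap_smul ℂ r (fr.kernel h x y), kernel, kernel, Finset.smul_sum]
  exact Finset.sum_congr rfl fun q _ => mul_smul _ _ _

theorem map_kernel (h : InnerProducts (Module.Dual ℂ (HolSections EB F E))) (x y : X)
    {N : Type*} [AddCommGroup N] [Module ℂ N] (l : E x ⊗[ℂ] ConjSpace (E y) →ₗ[ℂ] N) :
    l (fr.kernel h x y) = ∑ q : Fin fr.card × Fin fr.card,
      h.1 (fr.ev q.1) (fr.ev q.2) • l (tensorKernel (fr.sec q.1) (fr.sec q.2) x y) := by
  simp only [kernel, map_sum, map_smul]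

/-- For `σ = ξ ev_x` the coefficient `σ (s_a)` is `ξ (s_a(x))`, so the Gram expansion of `h` is term
by term `ξ ⊗ η̄` applied to the kernel. -/
theorem isBergmanKernel_kernel (h : InnerProducts (Module.Dual ℂ (HolSections EB F E))) :
    IsBergmanKernel EB F E h (fr.kernel h) := by
  intro x y ξ η
  rw [fr.inner_eq_sum, fr.map_kernel]
  rfl

theorem isPosSemidef_iff (h : InnerProducts (Module.Dual ℂ (HolSections EB F E))) :
    InnerProducts.IsPosSemidef h ↔
      ∀ (n : ℕ) (x : Fin n → X) (ξ : ∀ i, Module.Dual ℂ (E (x i))),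
        (Matrix.of fun i j => formTensorConj (ξ i) (ξ j)
          (fr.kernel h (x i) (x j))).PosSemidef := by
  constructor
  · intro hpos n x ξ
    rw [show (Matrix.of fun i j => formTensorConj (ξ i) (ξ j) (fr.kernel h (x i) (x j))) =
      Matrix.of fun i j => h.1 (ξ i ∘ₗ evalAt EB F E (x i)) (ξ j ∘ₗ evalAt EB F E (x j)) from
      Matrix.ext fun i j => (fr.isBergmanKernel_kernel h _ _ _ _).symm]
    exact InnerProducts.posSemidef_gram h hpos _
  · intro hM σ
    -- With these coefficients the combination of frame forms is `σ` itself, so the matrix at the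
    -- points of the frame already decides positivity.
    have h1 := InnerProducts.apply_sum_smul h fr.ev fun a => conj (σ (fr.sec a))
    simp only [Complex.conj_conj] at h1
    have h2 : ∑ a, σ (fr.sec a) • fr.ev a = σ := (fr.expand σ).symm
    rw [h2] at h1
    rw [h1, show (Matrix.of fun i j => h.1 (fr.ev i) (fr.ev j)) =
      Matrix.of fun i j => formTensorConj (fr.form i) (fr.form j)
        (fr.kernel h (fr.pt i) (fr.pt j)) from
      Matrix.ext fun i j => fr.isBergmanKernel_kernel h _ _ _ _]
    exact (Complex.nonneg_iff.1 ((hM _ fr.pt fr.form).dotProduct_mulVec_nonneg _)).1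

/-- The inner product with a given hermitian holomorphic kernel, computed in a frame. -/
def innerOf (L : HolHermKernels EB F E) :
    InnerProducts (Module.Dual ℂ (HolSections EB F E)) :=
  ⟨LinearMap.mk₂'ₛₗ (RingHom.id ℂ) (starRingEnd ℂ)
    (fun σ τ => ∑ q : Fin fr.card × Fin fr.card,
      formTensorConj (fr.form q.1) (fr.form q.2) (L.1 (fr.pt q.1) (fr.pt q.2)) *
        (σ (fr.sec q.1) * conj (τ (fr.sec q.2))))
    (fun σ σ' τ => by simp only [LinearMap.add_apply, add_mul, mul_add, Finset.sum_add_distrib])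
    (fun c σ τ => by
      simp only [LinearMap.smul_apply, smul_eq_mul, Finset.mul_sum, RingHom.id_apply]
      exact Finset.sum_congr rfl fun q _ => by ring)
    (fun σ τ τ' => by
      simp only [LinearMap.add_apply, map_add, mul_add, Finset.sum_add_distrib])
    (fun c σ τ => by
      simp only [LinearMap.smul_apply, smul_eq_mul, Finset.mul_sum, map_mul]
      exact Finset.sum_congr rfl fun q _ => by ring), fun σ τ => by
    simp only [LinearMap.mk₂'ₛₗ_apply, map_sum, map_mul, Complex.conj_conj,
      ← formTensorConj_tensorFlip, L.2.2]
    -- The flip has exchanged the two frame points in `L`; swapping the summation indices restores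
    -- the order.
    rw [← (Equiv.prodComm _ _).sum_comp]
    exact Finset.sum_congr rfl fun q _ =>
      congrArg₂ (· * ·) rfl (mul_comm _ _)⟩

theorem innerOf_apply (L : HolHermKernels EB F E) (σ τ : Module.Dual ℂ (HolSections EB F E)) :
    (fr.innerOf L).1 σ τ = ∑ q : Fin fr.card × Fin fr.card,
      formTensorConj (fr.form q.1) (fr.form q.2) (L.1 (fr.pt q.1) (fr.pt q.2)) *
        (σ (fr.sec q.1) * conj (τ (fr.sec q.2))) := rfl

section

variable [FiniteDimensional ℂ F]

theorem isBergmanKernel_iff (h : InnerProducts (Module.Dual ℂ (HolSections EB F E)))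
    (K : ∀ x y : X, E x ⊗[ℂ] ConjSpace (E y)) :
    IsBergmanKernel EB F E h K ↔ K = fr.kernel h := by
  refine ⟨fun hK => ?_, fun hK => hK ▸ fr.isBergmanKernel_kernel h⟩
  ext x y
  have : ∀ x, FiniteDimensional ℂ (E x) := finiteDimensional_fiber (F := F)
  exact eq_of_formTensorConj_eq fun ξ η =>
    (hK x y ξ η).symm.trans (fr.isBergmanKernel_kernel h x y ξ η)

theorem tensorFlip_kernel (h : InnerProducts (Module.Dual ℂ (HolSections EB F E))) (x y : X) :
    tensorFlip (E x) (E y) (fr.kernel h x y) = fr.kernel h y x := by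
  have : ∀ x, FiniteDimensional ℂ (E x) := finiteDimensional_fiber (F := F)
  refine eq_of_formTensorConj_eq fun η ξ => ?_
  rw [formTensorConj_tensorFlip, ← fr.isBergmanKernel_kernel h, ← fr.isBergmanKernel_kernel h]
  exact (h.2 _ _).symm

variable [ContMDiffVectorBundle ω F E 𝓘(ℂ, EB)]

theorem kernel_mem (h : InnerProducts (Module.Dual ℂ (HolSections EB F E))) :
    fr.kernel h ∈ HolHermKernels EB F E := by
  refine ⟨fun x₀ y₀ l => ?_, fr.tensorFlip_kernel h⟩
  refine ContMDiffOn.congr (contMDiffOn_finsetSum fun q _ => contMDiffOn_const.mul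
    (isHolKernel_tensorKernel (fr.sec q.1) (fr.sec q.2) x₀ y₀ l)) fun p _ =>
    fr.map_kernel h p.1 p.2 (l ∘ₗ tensorTriv F E x₀ y₀ p.1 p.2)

theorem diag_kernel_mem (h : InnerProducts (Module.Dual ℂ (HolSections EB F E))) :
    (fun x => fr.kernel h x x) ∈ SmoothHermSections EB F E := by
  refine ⟨fun x₀ l => ?_, fun x => fr.tensorFlip_kernel h x x⟩
  have hs : ∀ q : Fin fr.card × Fin fr.card, ContMDiffOn 𝓘(ℝ, EB) 𝓘(ℝ, ℂ) ∞
      (fun x => h.1 (fr.ev q.1) (fr.ev q.2) •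
        l (tensorTriv F E x₀ x₀ x x (tensorKernel (fr.sec q.1) (fr.sec q.2) x x)))
      (trivializationAt F E x₀).baseSet := fun q =>
    (contDiff_const_smul (𝕜 := ℝ) (h.1 (fr.ev q.1) (fr.ev q.2))).contMDiff.comp_contMDiffOn
      (isSmoothSection_tensorKernel (fr.sec q.1) (fr.sec q.2) x₀ l)
  exact (contMDiffOn_finsetSum fun q _ => hs q).congr fun p _ =>
    fr.map_kernel h p p (l ∘ₗ tensorTriv F E x₀ x₀ p p)

/-- Each slice of `L` in `x` is a holomorphic section, hence determined by its values on the frame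
(`h1`). Hermitian symmetry turns this into the same statement in `y` (`h2`), and together they
express `L` through its frame values. -/
theorem isBergmanKernel_innerOf (L : HolHermKernels EB F E) :
    IsBergmanKernel EB F E (fr.innerOf L) L.1 := by
  intro x y ξ η
  have h1 : ∀ (x y : X) (ξ : Module.Dual ℂ (E x)) (η : Module.Dual ℂ (E y)),
      formTensorConj ξ η (L.1 x y) = ∑ a, ξ (fr.sec a x) *
        formTensorConj (fr.form a) η (L.1 (fr.pt a) y) := fun x y ξ η => by
    have h := fr.apply_eq_sum (ξ ∘ₗ evalAt EB F E x) (L.2.1.contract y η)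
    simp only [L.2.1.apply_contract] at h
    exact (L.2.1.apply_contract x y ξ η).symm.trans h
  have h2 : ∀ a, formTensorConj (fr.form a) η (L.1 (fr.pt a) y) = ∑ b, conj (η (fr.sec b y)) *
      formTensorConj (fr.form a) (fr.form b) (L.1 (fr.pt a) (fr.pt b)) := fun a => by
    rw [← L.2.2 y (fr.pt a), formTensorConj_tensorFlip, h1 y, map_sum]
    refine Finset.sum_congr rfl fun b _ => ?_
    rw [map_mul, ← formTensorConj_tensorFlip, L.2.2]
  rw [h1, innerOf_apply, Fintype.sum_prod_type]
  refine Finset.sum_congr rfl fun a _ => ?_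
  rw [h2, Finset.mul_sum]
  refine Finset.sum_congr rfl fun b _ => ?_
  change _ * (ξ (fr.sec a x) * conj (η (fr.sec b y))) = _
  ring

/-- The linear isomorphism of inner products with their Bergman kernels. -/
def bergmanEquiv :
    InnerProducts (Module.Dual ℂ (HolSections EB F E)) ≃ₗ[ℝ] HolHermKernels EB F E where
  toFun h := ⟨fr.kernel h, fr.kernel_mem h⟩
  map_add' g h := Subtype.ext (fr.kernel_add g h)
  map_smul' r h := Subtype.ext (fr.kernel_smul r h)
  invFun := fr.innerOf
  left_inv h := InnerProducts.ext_apply fun σ τ => by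
    rw [fr.inner_eq_sum h, innerOf_apply]
    refine Finset.sum_congr rfl fun q _ => ?_
    rw [← fr.isBergmanKernel_kernel h]
    rfl
  right_inv L := Subtype.ext ((fr.isBergmanKernel_iff _ _).1 (fr.isBergmanKernel_innerOf L)).symm

/-- The linear map taking inner products to their Bergman sections. -/
def bergmanSection :
    InnerProducts (Module.Dual ℂ (HolSections EB F E)) →ₗ[ℝ] SmoothHermSections EB F E where
  toFun h := ⟨fun x => fr.kernel h x x, fr.diag_kernel_mem h⟩
  map_add' g h := Subtype.ext (funext fun x => congrFun (congrFun (fr.kernel_add g h) x) x)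
  map_smul' r h := Subtype.ext (funext fun x => congrFun (congrFun (fr.kernel_smul r h) x) x)

end

end HolSections.EvalFrame

/-! ### Polarization: from the diagonal to a neighbourhood of it -/

section Polarization

open Set Metric

/-- A function of two variables, holomorphic in the first and antiholomorphic in the second, that
vanishes on the diagonal of a ball vanishes on the square of the ball. -/
theorem sum_mul_conj_eq_zero_of_diag {V : Type*} [NormedAddCommGroup V] [NormedSpace ℂ V]
    {ι : Type*} (t : Finset ι) (a : ι → ℂ) (f g : ι → V → ℂ) {c : V} {r : ℝ}
    (hf : ∀ i, DifferentiableOn ℂ (f i) (ball c r)) (hg : ∀ i, DifferentiableOn ℂ (g i) (ball c r))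
    (h : ∀ z ∈ ball c r, ∑ i ∈ t, a i * (f i z * conj (g i z)) = 0) {z w : V}
    (hz : z ∈ ball c r) (hw : w ∈ ball c r) : ∑ i ∈ t, a i * (f i z * conj (g i w)) = 0 := by
  -- The complex line `α u = m + u • q` is chosen with `α I = z` and `α (-I) = w`. Then `u ↦ (α u, α
  -- (conj u))` runs through the diagonal for real `u` and reaches `(z, w)` at `u = I`.
  let m : V := (2⁻¹ : ℂ) • (z + w)
  let q : V := (2⁻¹ * -Complex.I : ℂ) • (z - w)
  let α : ℂ → V := fun u => m + u • q
  have hα : Continuous α := continuous_const.add (continuous_id.smul continuous_const)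
  have hα0 : α 0 = m := by simp [α]
  have hαI : α Complex.I = z := by
    have : Complex.I * (2⁻¹ * -Complex.I) = (2⁻¹ : ℂ) := by
      linear_combination (-2⁻¹ : ℂ) * Complex.I_mul_I
    simp only [α, m, q, smul_smul, this]
    module
  have hαI' : α (conj Complex.I) = w := by
    have : -Complex.I * (2⁻¹ * -Complex.I) = -(2⁻¹ : ℂ) := by
      linear_combination (2⁻¹ : ℂ) * Complex.I_mul_I
    simp only [α, m, q, smul_smul, Complex.conj_I, this]
    module
  have hm : m ∈ ball c r := by
    have h1 := convex_ball c r hz hw (by norm_num : (0 : ℝ) ≤ 2⁻¹) (by norm_num : (0 : ℝ) ≤ 2⁻¹)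
      (by norm_num)
    rw [← smul_add, ← Complex.coe_smul] at h1
    simpa [m] using h1
  -- Convex, because `α` and conjugation are real affine; this connects `0` with `I`.
  let D : Set ℂ := α ⁻¹' ball c r ∩ (fun u => α (conj u)) ⁻¹' ball c r
  have hDo : IsOpen D := (isOpen_ball.preimage hα).inter
    (isOpen_ball.preimage (hα.comp Complex.continuous_conj))
  have hαc : ∀ (u v : ℂ) (x y : ℝ), x + y = 1 → α (x • u + y • v) = x • α u + y • α v := by
    intro u v x y hxy
    have h1 : m = (x : ℂ) • m + (y : ℂ) • m := by
      rw [← add_smul, ← Complex.ofReal_add, hxy, Complex.ofReal_one, one_smul]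
    simp only [α, ← Complex.coe_smul, smul_eq_mul]
    nth_rewrite 1 [h1]
    module
  have hDc : Convex ℝ D := by
    intro u hu v hv x y hx hy hxy
    refine ⟨?_, ?_⟩
    · rw [mem_preimage, hαc u v x y hxy]
      exact convex_ball c r hu.1 hv.1 hx hy hxy
    · have h1 : conj (x • u + y • v) = x • conj u + y • conj v := by simp
      rw [mem_preimage, h1, hαc _ _ x y hxy]
      exact convex_ball c r hu.2 hv.2 hx hy hxy
  let G : ℂ → ℂ := fun u => ∑ i ∈ t, a i * (f i (α u) * conj (g i (α (conj u))))
  have hαd : Differentiable ℂ α := (differentiable_const _).add (differentiable_id.smul_const _)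
  have hG : AnalyticOnNhd ℂ G D := by
    refine DifferentiableOn.analyticOnNhd (fun u hu => ?_) hDo
    refine DifferentiableAt.differentiableWithinAt ?_
    refine DifferentiableAt.fun_sum fun i _ => DifferentiableAt.const_mul (DifferentiableAt.mul ?_ ?_) _
    · exact ((hf i).differentiableAt (isOpen_ball.mem_nhds hu.1)).comp u hαd.differentiableAt
    -- The two conjugations cancel: `u ↦ conj (g i (α (conj u)))` is holomorphic.
    · have h1 := (((hg i).differentiableAt (isOpen_ball.mem_nhds hu.2)).comp (conj u)
        hαd.differentiableAt).conj_conj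
      rwa [Complex.conj_conj] at h1
  have h0D : (0 : ℂ) ∈ D := by
    refine ⟨?_, ?_⟩
    · rwa [mem_preimage, hα0]
    · rwa [mem_preimage, map_zero, hα0]
  -- On real `u` the hypothesis on the diagonal applies, and the nonzero reals accumulate at `0`.
  have hfreq : ∃ᶠ u in 𝓝[≠] (0 : ℂ), G u = 0 := by
    have hev : ∀ᶠ x : ℝ in 𝓝[≠] 0, G (x : ℂ) = 0 := by
      have h1 : ∀ᶠ x : ℝ in 𝓝 0, (x : ℂ) ∈ D :=
        Complex.continuous_ofReal.continuousAt.eventually (hDo.mem_nhds (by simpa using h0D))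
      filter_upwards [mem_nhdsWithin_of_mem_nhds h1] with x hx
      simp only [G, Complex.conj_ofReal]
      exact h _ hx.1
    have htend : Filter.Tendsto (fun x : ℝ => (x : ℂ)) (𝓝[≠] 0) (𝓝[≠] 0) := by
      refine tendsto_nhdsWithin_iff.2 ⟨?_, ?_⟩
      · exact (Complex.continuous_ofReal.tendsto' 0 0 rfl).mono_left nhdsWithin_le_nhds
      · filter_upwards [self_mem_nhdsWithin] with x hx
        simpa using hx
    exact htend.frequently hev.frequently
  have hI : Complex.I ∈ D := by
    refine ⟨?_, ?_⟩
    · rwa [mem_preimage, hαI]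
    · rwa [mem_preimage, hαI']
  have h2 := hG.eqOn_zero_of_preconnected_of_frequently_eq_zero hDc.isPreconnected h0D hfreq hI
  simpa only [G, hαI, hαI', Pi.zero_apply] using h2

end Polarization

/-! ### Continuity of point values -/

section Evaluations

open HolSections Set

variable {EB : Type*} [NormedAddCommGroup EB] [NormedSpace ℂ EB]
  {F : Type*} [NormedAddCommGroup F] [NormedSpace ℂ F]
  {X : Type*} [TopologicalSpace X] [ChartedSpace EB X]
  {E : X → Type*} [TopologicalSpace (TotalSpace F E)] [∀ x, TopologicalSpace (E x)]
  [∀ x, AddCommGroup (E x)] [∀ x, Module ℂ (E x)] [FiberBundle F E] [VectorBundle ℂ F E]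

/-- A single point is a compact set, so uniform convergence on compact sets controls the value
there. -/
theorem HolHermKernels.continuous_formTensorConj (x y : X) (ξ : Module.Dual ℂ (E x))
    (η : Module.Dual ℂ (E y)) :
    Continuous fun L : HolHermKernels EB F E => formTensorConj ξ η (L.1 x y) := by
  have hx := mem_baseSet_trivializationAt F E x
  have hy := mem_baseSet_trivializationAt F E y
  obtain ⟨ξ', hξ⟩ := exists_comp_trivAt_eq (F := F) hx ξ
  obtain ⟨η', hη⟩ := exists_comp_trivAt_eq (F := F) hy η
  have h1 : Continuous fun L : HolHermKernels EB F E => UniformOnFun.ofFun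
      {C : Set (X × X) | IsCompact C ∧
        C ⊆ (trivializationAt F E x).baseSet ×ˢ (trivializationAt F E y).baseSet}
      (fun p : X × X => formTensorConj ξ' η' (tensorTriv F E x y p.1 p.2 (L.1 p.1 p.2))) :=
    continuous_iInf_dom (i := x) (continuous_iInf_dom (i := y)
      (continuous_iInf_dom (i := formTensorConj ξ' η') continuous_induced_dom))
  have h2 := (UniformOnFun.uniformContinuous_eval_of_mem ℂ
    {C : Set (X × X) | IsCompact C ∧
        C ⊆ (trivializationAt F E x).baseSet ×ˢ (trivializationAt F E y).baseSet}
    (mem_singleton (x, y)) ⟨isCompact_singleton, singleton_subset_iff.2 ⟨hx, hy⟩⟩).continuous.comp h1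
  refine h2.congr fun L => ?_
  rw [← hξ, ← hη, ← formTensorConj_map]
  rfl

theorem SmoothHermSections.continuous_formTensorConj (x : X) (ξ η : Module.Dual ℂ (E x)) :
    Continuous fun k : SmoothHermSections EB F E => formTensorConj ξ η (k.1 x) := by
  have hx := mem_baseSet_trivializationAt F E x
  obtain ⟨ξ', hξ⟩ := exists_comp_trivAt_eq (F := F) hx ξ
  obtain ⟨η', hη⟩ := exists_comp_trivAt_eq (F := F) hx η
  let φ := chartAt EB x
  have h1 : Continuous fun k : SmoothHermSections EB F E => UniformOnFun.ofFun
      {C : Set EB | IsCompact C ∧ C ⊆ chartDomain EB F E x}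
      (iteratedFDeriv ℝ 0 fun z : EB => formTensorConj ξ' η'
        (tensorTriv F E x x (φ.symm z) (φ.symm z) (k.1 (φ.symm z)))) :=
    -- Point values are controlled by the derivatives of order `0`.
    continuous_iInf_dom (i := x) (continuous_iInf_dom (i := formTensorConj ξ' η')
      (continuous_iInf_dom (i := 0) continuous_induced_dom))
  have h2 := (UniformOnFun.uniformContinuous_eval_of_mem (EB [×0]→L[ℝ] ℂ)
    {C : Set EB | IsCompact C ∧ C ⊆ chartDomain EB F E x} (mem_singleton (φ x))
    ⟨isCompact_singleton, singleton_subset_iff.2 (mem_chartDomain_self x)⟩).continuous.comp h1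
  have h3 := (ContinuousMultilinearMap.apply ℝ (fun _ : Fin 0 => EB) ℂ 0).continuous.comp h2
  refine h3.congr fun k => ?_
  change iteratedFDeriv ℝ 0 (fun z : EB => formTensorConj ξ' η'
        (tensorTriv F E x x (φ.symm z) (φ.symm z) (k.1 (φ.symm z)))) (φ x) 0 = _
  rw [iteratedFDeriv_zero_apply, φ.left_inv (mem_chart_source EB x), ← hξ, ← hη,
    ← formTensorConj_map]
  rfl

variable (EB F E) in
/-- The values of a section of `E ⊗ Ē` on all forms `ξ ⊗ η̄`. -/
def SmoothHermSections.formValues : SmoothHermSections EB F E →ₗ[ℝ]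
    ((Σ x : X, Module.Dual ℂ (E x) × Module.Dual ℂ (E x)) → ℂ) where
  toFun k q := formTensorConj q.2.1 q.2.2 (k.1 q.1)
  map_add' k k' := funext fun q => map_add (formTensorConj q.2.1 q.2.2) (k.1 q.1) (k'.1 q.1)
  map_smul' r k := funext fun q =>
    LinearMap.map_smul_of_tower (formTensorConj q.2.1 q.2.2) r (k.1 q.1)

end Evaluations

/-- The composite `ψ ∘ f` is an injective linear map from a finite dimensional Hausdorff space to a
Hausdorff one, hence an embedding, and this forces `f` to be one. The topology of `M` need not be
known to be Hausdorff or linear. -/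
theorem isEmbedding_of_continuous_coords {V M ι : Type*} [AddCommGroup V] [Module ℝ V]
    [TopologicalSpace V] [IsTopologicalAddGroup V] [ContinuousSMul ℝ V] [T2Space V]
    [FiniteDimensional ℝ V] [AddCommGroup M] [Module ℝ M] [TopologicalSpace M]
    (f : V →ₗ[ℝ] M) (hf : Continuous f) (hfi : Function.Injective f) (ψ : M →ₗ[ℝ] (ι → ℂ))
    (hψ : Continuous ψ) (hψi : Function.Injective ψ) : Topology.IsEmbedding f := by
  have hinj : Function.Injective (ψ ∘ₗ f) := hψi.comp hfi
  have hc := LinearMap.isClosedEmbedding_of_injective (LinearMap.ker_eq_bot.2 hinj)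
  exact Topology.IsEmbedding.of_comp hf hψ hc.isEmbedding

/-! ### Injectivity of `β` and the topological statements -/

namespace HolSections.EvalFrame

open HolSections Set Metric

variable {EB : Type*} [NormedAddCommGroup EB] [NormedSpace ℂ EB]
  {F : Type*} [NormedAddCommGroup F] [NormedSpace ℂ F] [FiniteDimensional ℂ F]
  {X : Type*} [TopologicalSpace X] [ChartedSpace EB X]
  {E : X → Type*} [TopologicalSpace (TotalSpace F E)] [∀ x, TopologicalSpace (E x)]
  [∀ x, AddCommGroup (E x)] [∀ x, Module ℂ (E x)] [FiberBundle F E] [VectorBundle ℂ F E]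
  [ContMDiffVectorBundle ω F E 𝓘(ℂ, EB)] (fr : EvalFrame EB F E)

/-- In the chart and trivialization at `y` every component of the kernel is a finite sum of products
`f(z) conj(g(w))` that vanishes on the diagonal of a ball. Polarization with `w` at the centre makes
the slice at `y` vanish nearby. -/
theorem eventually_contract_kernel_eq_zero [IsManifold 𝓘(ℂ, EB) ω X]
    (h : InnerProducts (Module.Dual ℂ (HolSections EB F E)))
    (hd : ∀ x, fr.kernel h x x = 0) (y : X) (η : Module.Dual ℂ (E y)) :
    ∀ᶠ x in 𝓝 y, (fr.kernel_mem h).1.contract y η x = 0 := by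
  obtain ⟨r, hr, hball⟩ := Metric.isOpen_iff.1 (isOpen_chartDomain (EB := EB) (F := F) (E := E) y)
    _ (mem_chartDomain_self y)
  let φ := chartAt EB y
  obtain ⟨η', hη⟩ := exists_comp_trivAt_eq (F := F) (mem_baseSet_trivializationAt F E y) η
  filter_upwards [(φ.isOpen_inter_preimage isOpen_ball).mem_nhds
    ⟨mem_chart_source EB y, mem_ball_self hr⟩] with x hx
  have hxb : x ∈ (trivializationAt F E y).baseSet := by
    have := (hball hx.2).2
    rwa [mem_preimage, φ.left_inv hx.1] at this
  refine trivAt_injective hxb ?_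
  rw [map_zero]
  refine (Module.forall_dual_apply_eq_zero_iff ℂ _).1 fun ξ => ?_
  have hdiff : ∀ (s : HolSections EB F E) (ζ : Module.Dual ℂ F),
      DifferentiableOn ℂ (fun z => ζ (localRep EB F y s z)) (ball (φ y) r) := fun s ζ =>
    (LinearMap.toContinuousLinearMap ζ).differentiable.comp_differentiableOn
      ((analyticOnNhd_localRep s y).mono hball).differentiableOn
  have hrep : ∀ z w : EB, formTensorConj ξ η' (tensorTriv F E y y (φ.symm z) (φ.symm w)
      (fr.kernel h (φ.symm z) (φ.symm w))) = ∑ q : Fin fr.card × Fin fr.card,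
        h.1 (fr.ev q.1) (fr.ev q.2) * (ξ (localRep EB F y (fr.sec q.1) z) *
          conj (η' (localRep EB F y (fr.sec q.2) w))) := fun z w =>
    fr.map_kernel h _ _ (formTensorConj ξ η' ∘ₗ tensorTriv F E y y _ _)
  have hzero := sum_mul_conj_eq_zero_of_diag Finset.univ
    (fun q : Fin fr.card × Fin fr.card => h.1 (fr.ev q.1) (fr.ev q.2))
    (fun q z => ξ (localRep EB F y (fr.sec q.1) z))
    (fun q z => η' (localRep EB F y (fr.sec q.2) z))
    (fun q => hdiff (fr.sec q.1) ξ) (fun q => hdiff (fr.sec q.2) η')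
    (fun z _ => by rw [← hrep, hd, map_zero, map_zero]) hx.2 (mem_ball_self hr)
  rw [← hrep, φ.left_inv hx.1, φ.left_inv (mem_chart_source EB y), tensorTriv,
    formTensorConj_map] at hzero
  change (ξ ∘ₗ trivAt F E y x) _ = 0
  rw [IsHolKernel.apply_contract]
  rwa [hη] at hzero

/-- Each slice vanishes near its base point, hence everywhere by the identity theorem. In particular
all Gram entries of `h` on the frame are zero. -/
theorem bergmanSection_injective [IsManifold 𝓘(ℂ, EB) ω X] [PreconnectedSpace X] :
    Function.Injective fr.bergmanSection := by
  refine (injective_iff_map_eq_zero _).2 fun h hh => ?_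
  have hd : ∀ x, fr.kernel h x x = 0 := fun x => congrFun (congrArg Subtype.val hh) x
  refine InnerProducts.ext_apply fun σ τ => ?_
  rw [fr.inner_eq_sum]
  refine Finset.sum_eq_zero fun q _ => ?_
  rw [ev, ev, fr.isBergmanKernel_kernel h, ← (fr.kernel_mem h).1.apply_contract,
    eq_zero_of_eventually_eq_zero _ (fr.eventually_contract_kernel_eq_zero h hd _ _), map_zero,
    zero_mul]

theorem continuous_bergmanEquiv : Continuous fr.bergmanEquiv := by
  refine continuous_iInf_rng.2 fun x₀ => continuous_iInf_rng.2 fun y₀ =>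
    continuous_iInf_rng.2 fun l => continuous_induced_rng.2 ?_
  refine UniformOnFun.continuous_ofFun_of_eq_sum Finset.univ _
    (fun (q : Fin fr.card × Fin fr.card) h => h.1 (fr.ev q.1) (fr.ev q.2))
    (fun q p => l (tensorTriv F E x₀ y₀ p.1 p.2 (tensorKernel (fr.sec q.1) (fr.sec q.2) p.1 p.2)))
    (fun q => InnerProducts.continuous_apply _ _) (fun C hC q => ?_) (fun C _ p _ h => ?_)
  · exact hC.1.exists_bound_of_continuousOn
      ((isHolKernel_tensorKernel (fr.sec q.1) (fr.sec q.2) x₀ y₀ l).continuousOn.mono hC.2)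
  · exact fr.map_kernel h p.1 p.2 (l ∘ₗ tensorTriv F E x₀ y₀ p.1 p.2)

/-- The inverse only reads the kernel at the finitely many pairs of frame points. -/
theorem continuous_bergmanEquiv_symm : Continuous fr.bergmanEquiv.symm := by
  refine continuous_induced_rng.2 (continuous_pi fun p => ?_)
  exact continuous_finsetSum _ fun q _ =>
    (HolHermKernels.continuous_formTensorConj _ _ _ _).mul continuous_const

theorem contDiffOn_apply_tensorTriv_tensorKernel [IsManifold 𝓘(ℂ, EB) ω X]
    (s t : HolSections EB F E) (x₀ : X) (l : Module.Dual ℂ (F ⊗[ℂ] ConjSpace F)) :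
    ContDiffOn ℝ ∞ (fun z : EB => l (tensorTriv F E x₀ x₀ ((chartAt EB x₀).symm z)
      ((chartAt EB x₀).symm z) (tensorKernel s t ((chartAt EB x₀).symm z)
        ((chartAt EB x₀).symm z)))) (chartDomain EB F E x₀) := by
  obtain ⟨n, ξ, η, rfl⟩ := exists_eq_sum_formTensorConj l
  simp only [apply_tensorTriv_tensorKernel]
  have hreal : ∀ (s : HolSections EB F E) (ζ : Module.Dual ℂ F),
      ContDiffOn ℝ ∞ (fun z => ζ (localRep EB F x₀ s z)) (chartDomain EB F E x₀) := fun s ζ =>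
    (((LinearMap.toContinuousLinearMap ζ).contDiff.comp_contDiffOn
      (contDiffOn_localRep s x₀)).restrict_scalars ℝ).of_le le_top
  exact ContDiffOn.sum fun i _ => (hreal s (ξ i)).mul
    (Complex.conjCLE.contDiff.comp_contDiffOn (hreal t (η i)))

theorem continuous_bergmanSection [IsManifold 𝓘(ℂ, EB) ω X] : Continuous fr.bergmanSection := by
  refine continuous_iInf_rng.2 fun x₀ => continuous_iInf_rng.2 fun l =>
    continuous_iInf_rng.2 fun m => continuous_induced_rng.2 ?_
  let φ := chartAt EB x₀
  let g : Fin fr.card × Fin fr.card → EB → ℂ := fun q z =>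
    l (tensorTriv F E x₀ x₀ (φ.symm z) (φ.symm z)
      (tensorKernel (fr.sec q.1) (fr.sec q.2) (φ.symm z) (φ.symm z)))
  have hg : ∀ q, ContDiffOn ℝ ∞ (g q) (chartDomain EB F E x₀) := fun q =>
    contDiffOn_apply_tensorTriv_tensorKernel (fr.sec q.1) (fr.sec q.2) x₀ l
  have hO := isOpen_chartDomain (EB := EB) (F := F) (E := E) x₀
  refine UniformOnFun.continuous_ofFun_of_eq_sum Finset.univ _
    (fun (q : Fin fr.card × Fin fr.card) h => h.1 (fr.ev q.1) (fr.ev q.2))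
    (fun q => iteratedFDeriv ℝ m (g q))
    (fun q => InnerProducts.continuous_apply _ _) (fun C hC q => ?_) (fun C hC z hz h => ?_)
  · refine hC.1.exists_bound_of_continuousOn ?_
    -- The functions are smooth only on the open chart domain, where derivatives within it agree
    -- with full ones.
    have h1 := (hg q).continuousOn_iteratedFDerivWithin (m := m) (mod_cast le_top) hO.uniqueDiffOn
    exact (h1.congr fun z hz => (iteratedFDerivWithin_of_isOpen m hO hz).symm).mono hC.2
  · have hzO : z ∈ chartDomain EB F E x₀ := hC.2 hz
    have hat : ∀ q, ContDiffAt ℝ m (g q) z := fun q =>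
      ((hg q).contDiffAt (hO.mem_nhds hzO)).of_le (mod_cast le_top)
    have h1 : (fun z : EB => l (tensorTriv F E x₀ x₀ (φ.symm z) (φ.symm z)
        ((fr.bergmanSection h).1 (φ.symm z)))) =
        fun z => ∑ q, (h.1 (fr.ev q.1) (fr.ev q.2) • g q) z :=
      funext fun z => fr.map_kernel h _ _ (l ∘ₗ tensorTriv F E x₀ x₀ _ _)
    change iteratedFDeriv ℝ m (fun z : EB => l (tensorTriv F E x₀ x₀ (φ.symm z) (φ.symm z)
        ((fr.bergmanSection h).1 (φ.symm z)))) z = _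
    have h2 : ∀ q, ContDiffAt ℝ m (h.1 (fr.ev q.1) (fr.ev q.2) • g q) z := fun q =>
      (hat q).const_smul (h.1 (fr.ev q.1) (fr.ev q.2))
    rw [h1, iteratedFDeriv_fun_sum_apply fun q _ => h2 q]
    exact Finset.sum_congr rfl fun q _ => iteratedFDeriv_const_smul_apply (hat q)

theorem isEmbedding_bergmanSection [IsManifold 𝓘(ℂ, EB) ω X] [PreconnectedSpace X] :
    Topology.IsEmbedding fr.bergmanSection := by
  have := fr.finiteDimensional_innerProducts
  refine isEmbedding_of_continuous_coords
    (V := InnerProducts (Module.Dual ℂ (HolSections EB F E))) (M := SmoothHermSections EB F E)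
    fr.bergmanSection fr.continuous_bergmanSection
    fr.bergmanSection_injective (SmoothHermSections.formValues EB F E)
    (continuous_pi fun q => SmoothHermSections.continuous_formTensorConj _ _ _) fun k k' hk =>
    Subtype.ext <| funext fun x => ?_
  have := finiteDimensional_fiber (F := F) (E := E) x
  exact eq_of_formTensorConj_eq fun ξ η => congrFun hk ⟨x, ξ, η⟩

end HolSections.EvalFrame

end

theorem theorem4p1
    {EB : Type*} [NormedAddCommGroup EB] [NormedSpace ℂ EB] [FiniteDimensional ℂ EB]
    {F : Type*} [NormedAddCommGroup F] [NormedSpace ℂ F] [FiniteDimensional ℂ F]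
    {X : Type*} [TopologicalSpace X] [T2Space X] [CompactSpace X] [ChartedSpace EB X]
    [IsManifold 𝓘(ℂ, EB) ω X]
    (E : X → Type*) [TopologicalSpace (TotalSpace F E)] [∀ x, TopologicalSpace (E x)]
    [∀ x, AddCommGroup (E x)] [∀ x, Module ℂ (E x)] [FiberBundle F E] [VectorBundle ℂ F E]
    [ContMDiffVectorBundle ω F E 𝓘(ℂ, EB)] :
    ∃ (B : InnerProducts (Module.Dual ℂ (HolSections EB F E)) ≃L[ℝ] HolHermKernels EB F E)
      (β : InnerProducts (Module.Dual ℂ (HolSections EB F E)) →L[ℝ] SmoothHermSections EB F E),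
      -- `B h` is the Bergman kernel of `h`, and `β h` is its restriction to the diagonal
      (∀ h K, IsBergmanKernel EB F E h K ↔ K = (B h).1) ∧
      (∀ h x, (β h).1 x = (B h).1 x x) ∧
      -- `β` is an isomorphism of topological vector spaces onto its image
      (PreconnectedSpace X → Topology.IsEmbedding β) ∧
      -- positive semidefiniteness
      (∀ h, InnerProducts.IsPosSemidef h ↔
        ∀ (n : ℕ) (x : Fin n → X) (ξ : ∀ i, Module.Dual ℂ (E (x i))),
          (Matrix.of fun i j => formTensorConj (ξ i) (ξ j) ((B h).1 (x i) (x j))).PosSemidef) := by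
  obtain ⟨fr⟩ := HolSections.nonempty_evalFrame (EB := EB) (F := F) (E := E)
  refine ⟨{ fr.bergmanEquiv with
      continuous_toFun := fr.continuous_bergmanEquiv
      continuous_invFun := fr.continuous_bergmanEquiv_symm },
    ⟨fr.bergmanSection, fr.continuous_bergmanSection⟩, ?_, fun h x => rfl, ?_, ?_⟩
  · exact fun h K => fr.isBergmanKernel_iff h K
  · intro hX
    exact fr.isEmbedding_bergmanSection
  · exact fun h => fr.isPosSemidef_iff h
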